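/- **Theorem.** For every $\lambda$-term $M$, the normalized Taylor expansion of the call-by-value Böhm tree of $M$ equals the $\mathsf r$-normal form of the call-by-value Taylor expansion of $M$: $$\mathcal T^\circ(\mathrm{BT}(M)) = \mathrm{NF}(\mathcal T(M)).$$ The notions are the following; all terms are considered up to renaming of bound variables. *$\lambda$-terms.* $\lambda$-terms are $M ::= x \mid \lambda x.M \mid MN$; values $V$ are variables and abstractions. The reduction $\to_{\mathsf v}$ is the contextual closure of $(\lambda x.M)V\to M[x:=V]$ ($V$ a value), $(\lambda x.M)NP\to(\lambda x.MP)N$ ($x$ not free in $P$), and $V((\lambda x.M)N)\to(\lambda x.VM)N$ ($V$ a value, $x$ not free in $V$); $\twoheadrightarrow_{\mathsf v}$ is its reflexive and transitive closure. *Böhm trees.* On $\lambda$-terms possibly containing a constant $\bot$, $\sqsubseteq$ is the context-closed preorder generated by $\bot\sqsubseteq x$ and $\bot\sqsubseteq\lambda x.M$. The set $\mathcal A$ of approximants is generated by $$A ::= B\mid(\lambda x.A)(yBA_1\cdots A_k),\qquad B::= x\mid\lambda x.A\mid\bot\mid xBA_1\cdots A_k\qquad(k\ge0).$$ For a $\lambda$-term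 $M$, $\mathcal A(M)=\{A\in\mathcal A\mid A\sqsubseteq N \text{ for some $\lambda$-term } N \text{ with } M\twoheadrightarrow_{\mathsf v}N\}$, and $\mathrm{BT}(M)=\bigsqcup\mathcal A(M)$ is the (possibly infinite, possibly empty) tree whose finite approximants are the elements of $\mathcal A(M)$. *Resource calculus.* Resource values are $v::=x\mid\lambda x.t$ and simple terms are $s,t::=st\mid[v_1,\dots,v_k]$ ($k\ge 0$), where $[v_1,\dots,v_k]$ is a finite multiset; resource terms $e$ are resource values and simple terms. The linear substitution $t\langle x:=v_1,\dots,v_n\rangle$ is the finite set of all terms obtained by replacing the free occurrences of $x$ in $t$ bijectively by $v_1,\dots,v_n$; it is $\emptyset$ if the number of these occurrences is not $n$. The relation $\to_{\mathsf r}$ from resource terms to finite sets of resource terms is the closure under all constructors (extended to sets elementwise in each argument; in a bag, one element is reduced) of $$[\lambda x.t][v_1,\dots,v_n]\to t\langle x:=v_1,\dots,v_n\rangle,\qquad [v_1,\dots,v_n]\,t\to\emptyset\ (n\ne1),$$ $$[\lambda x.t]s_1s_2\to\{[\lambda x.ts_2]s_1\}\ (x\text{ not free in }s_2),\qquad [v]([\lambda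 x.t]s)\to\{[\lambda x.[v]t]s\}\ (x\text{ not free in }v).$$ It is extended to finite sets by $\{e\}\cup E_2\to_{\mathsf r}E_1\cup E_2$ whenever $e\to_{\mathsf r}E_1$ and $e\notin E_2$. For a set $E$ of resource terms, $\mathrm{NF}(E)=\bigcup_{e\in E}\mathrm{nf}_{\mathsf r}(e)$, where $\mathrm{nf}_{\mathsf r}(e)$ is the $\to_{\mathsf r}$-normal form of $\{e\}$. *Taylor expansions.* Write $[x^n]$ for the bag with $n$ occurrences of $x$. For $\lambda$-terms, let $\mathcal T(x)=\{[x^n]\mid n\ge0\}$, $\mathcal T(\lambda x.N)=\{[\lambda x.t_1,\dots,\lambda x.t_n]\mid n\ge0,\ t_i\in\mathcal T(N)\}$ and $\mathcal T(PQ)=\{st\mid s\in\mathcal T(P),\ t\in\mathcal T(Q)\}$. For approximants, let - $\mathcal T^\circ(\bot)=\{[\,]\}$ and $\mathcal T^\circ(x)=\{[x^n]\mid n\ge0\}$; - $\mathcal T^\circ(\lambda x.A)=\{[\lambda x.t_1,\dots,\lambda x.t_n]\mid n\ge0,\ t_i\in\mathcal T^\circ(A)\}$; - $\mathcal T^\circ(xBA_1\cdots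 A_k)=\{[x]t_0t_1\cdots t_k\mid t_0\in\mathcal T^\circ(B),\ t_i\in\mathcal T^\circ(A_i)\}$; - $\mathcal T^\circ((\lambda x.A)(yBA_1\cdots A_k))=\{[\lambda x.s]t\mid s\in\mathcal T^\circ(A),\ t\in\mathcal T^\circ(yBA_1\cdots A_k)\}$. Finally $\mathcal T^\circ(\mathrm{BT}(M))=\bigcup_{A\in\mathcal A(M)}\mathcal T^\circ(A)$. -/

import Mathlib

namespace CbV

/-! ### Lambda-terms and the call-by-value reductions

Terms up to renaming of bound variables are represented with de Bruijn indices: a variable is a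
natural number, and an index that exceeds the number of enclosing binders is a free variable. -/

/-- `λ`-terms. -/
inductive Lam : Type
  | var : ℕ → Lam
  | lam : Lam → Lam
  | app : Lam → Lam → Lam

namespace Lam

/-- Values: variables and abstractions. -/
inductive IsValue : Lam → Prop
  | var (n : ℕ) : IsValue (var n)
  | lam (M : Lam) : IsValue (lam M)

/-- Insert a fresh variable at index `c`: every free index `≥ c` is incremented. -/
def shift : ℕ → Lam → Lam
  | c, var n => var (if n < c then n else n + 1)
  | c, lam M => lam (shift (c + 1) M)
  | c, app M N => app (shift c M) (shift c N)

/-- Capture-avoiding substitution of a term for the free index `k`, which disappears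
(greater indices are decremented). -/
def subst : ℕ → Lam → Lam → Lam
  | k, V, var n => if n = k then V else if n < k then var n else var (n - 1)
  | k, V, lam M => lam (subst (k + 1) (shift 0 V) M)
  | k, V, app M N => app (subst k V M) (subst k V N)

/-- One-step `v`-reduction: the contextual closure of `β_v`, `σ₁` and `σ₃`. The side conditions
of the `σ`-rules (no capture) are ensured by `shift`. -/
inductive Step : Lam → Lam → Prop
  | beta (M V : Lam) : IsValue V → Step (app (lam M) V) (subst 0 V M)
  | sigma1 (M N P : Lam) :
      Step (app (app (lam M) N) P) (app (lam (app M (shift 0 P))) N)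
  | sigma3 (V M N : Lam) : IsValue V →
      Step (app V (app (lam M) N)) (app (lam (app (shift 0 V) M)) N)
  | lam {M N : Lam} : Step M N → Step (lam M) (lam N)
  | appL {M N : Lam} (P : Lam) : Step M N → Step (app M P) (app N P)
  | appR (P : Lam) {M N : Lam} : Step M N → Step (app P M) (app P N)

/-- Multistep `v`-reduction. -/
def Steps : Lam → Lam → Prop := Relation.ReflTransGen Step

end Lam

/-! ### Approximants and Böhm trees -/

/-- `λ`-terms possibly containing the constant `⊥`. -/
inductive LamBot : Type
  | bot : LamBot
  | var : ℕ → LamBot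
  | lam : LamBot → LamBot
  | app : LamBot → LamBot → LamBot

/-- The inclusion of `λ`-terms into `λ⊥`-terms. -/
def Lam.toBot : Lam → LamBot
  | .var n => .var n
  | .lam M => .lam M.toBot
  | .app M N => .app M.toBot N.toBot

namespace LamBot

/-- The context-closed preorder generated by `⊥ ⊑ x` and `⊥ ⊑ λx.M`. -/
inductive Le : LamBot → LamBot → Prop
  | bot_var (n : ℕ) : Le bot (var n)
  | bot_lam (M : LamBot) : Le bot (lam M)
  | refl (M : LamBot) : Le M M
  | trans {M N P : LamBot} : Le M N → Le N P → Le M P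
  | lam {M N : LamBot} : Le M N → Le (lam M) (lam N)
  | appL {M N : LamBot} (P : LamBot) : Le M N → Le (app M P) (app N P)
  | appR (P : LamBot) {M N : LamBot} : Le M N → Le (app P M) (app P N)

mutual
/-- `A ::= B ∣ (λx.A)(y B A₁ ⋯ Aₖ)`, `k ≥ 0`. -/
inductive IsA : LamBot → Prop
  | ofB {B : LamBot} : IsB B → IsA B
  | redex {A N : LamBot} : IsA A → IsSpine N → IsA (app (lam A) N)
/-- `B ::= x ∣ λx.A ∣ ⊥ ∣ x B A₁ ⋯ Aₖ`, `k ≥ 0`. -/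
inductive IsB : LamBot → Prop
  | var (n : ℕ) : IsB (var n)
  | lam {A : LamBot} : IsA A → IsB (lam A)
  | bot : IsB bot
  | spine {N : LamBot} : IsSpine N → IsB N
/-- The terms `x B A₁ ⋯ Aₖ` with `k ≥ 0`, generated by adding the arguments one by one. -/
inductive IsSpine : LamBot → Prop
  | head (n : ℕ) {B : LamBot} : IsB B → IsSpine (app (var n) B)
  | snoc {N A : LamBot} : IsSpine N → IsA A → IsSpine (app N A)
end

end LamBot

/-- The set `𝒜` of approximants. -/
def Approximant : Type := {A : LamBot // LamBot.IsA A}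

instance : Preorder Approximant where
  le A B := LamBot.Le A.1 B.1
  le_refl A := LamBot.Le.refl A.1
  le_trans _ _ _ h₁ h₂ := LamBot.Le.trans h₁ h₂

/-- The set `𝒜(M)` of approximants of a `λ`-term: those lying below some `v`-reduct of `M`. -/
def approximants (M : Lam) : Set Approximant :=
  {A | ∃ N : Lam, Lam.Steps M N ∧ LamBot.Le A.1 N.toBot}

/-- The Böhm tree `BT(M) = ⨆ 𝒜(M)`. A (possibly infinite, possibly empty) Böhm-like tree is
represented by the downward closed set of its finite approximants, so that the supremum is taken
in the order completion of `𝒜` by lower sets; `LowerSet.Iic A` is the finite tree `A`, and the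
supremum of the empty set is the empty tree. -/
def bohmTree (M : Lam) : LowerSet Approximant :=
  ⨆ A ∈ approximants M, LowerSet.Iic A

/-- The finite approximants of `BT(M)` are exactly the elements of `𝒜(M)`. -/
theorem mem_bohmTree (M : Lam) (A : Approximant) : A ∈ bohmTree M ↔ A ∈ approximants M := by
  simp only [bohmTree, LowerSet.mem_iSup_iff, LowerSet.mem_Iic_iff]
  constructor
  · rintro ⟨A', ⟨N, hN, hle⟩, h⟩
    exact ⟨N, hN, LamBot.Le.trans h hle⟩
  · intro h
    exact ⟨A, h, le_refl A⟩

/-! ### The call-by-value resource calculus -/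

/-- The syntactic categories: resource values, simple terms, and bags (which are those simple
terms that are not applications). -/
inductive RSort : Type
  | val
  | sim
  | bag

/-- Resource expressions in which the content of a bag is still ordered. -/
inductive PreRes : RSort → Type
  | var : ℕ → PreRes .val
  | lam : PreRes .sim → PreRes .val
  | app : PreRes .sim → PreRes .sim → PreRes .sim
  | ofBag : PreRes .bag → PreRes .sim
  | nil : PreRes .bag
  | cons : PreRes .val → PreRes .bag → PreRes .bag

namespace PreRes

/-- Equality up to reordering of the bags, at any depth: the congruence generated by the exchange
of two consecutive elements of a bag. -/
inductive Equiv : {s : RSort} → PreRes s → PreRes s → Prop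
  | refl {s : RSort} (e : PreRes s) : Equiv e e
  | symm {s : RSort} {e f : PreRes s} : Equiv e f → Equiv f e
  | trans {s : RSort} {e f g : PreRes s} : Equiv e f → Equiv f g → Equiv e g
  | lam {t t' : PreRes .sim} : Equiv t t' → Equiv (lam t) (lam t')
  | app {s s' t t' : PreRes .sim} : Equiv s s' → Equiv t t' → Equiv (app s t) (app s' t')
  | ofBag {b b' : PreRes .bag} : Equiv b b' → Equiv (ofBag b) (ofBag b')
  | cons {v v' : PreRes .val} {b b' : PreRes .bag} :
      Equiv v v' → Equiv b b' → Equiv (cons v b) (cons v' b')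
  | swap (v w : PreRes .val) (b : PreRes .bag) : Equiv (cons v (cons w b)) (cons w (cons v b))

instance setoid (s : RSort) : Setoid (PreRes s) where
  r := Equiv
  iseqv := ⟨Equiv.refl, Equiv.symm, Equiv.trans⟩

/-- Insert a fresh variable at index `c`: every free index `≥ c` is incremented. -/
def shift : {s : RSort} → ℕ → PreRes s → PreRes s
  | _, c, var n => var (if n < c then n else n + 1)
  | _, c, lam t => lam (shift (c + 1) t)
  | _, c, app t u => app (shift c t) (shift c u)
  | _, c, ofBag b => ofBag (shift c b)
  | _, _, nil => nil
  | _, c, cons v b => cons (shift c v) (shift c b)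

theorem shift_equiv {s : RSort} {e f : PreRes s} (h : Equiv e f) :
    ∀ c : ℕ, Equiv (shift c e) (shift c f) := by
  induction h with
  | refl e => exact fun c => .refl _
  | symm _ ih => exact fun c => (ih c).symm
  | trans _ _ ih₁ ih₂ => exact fun c => (ih₁ c).trans (ih₂ c)
  | lam _ ih => exact fun c => .lam (ih (c + 1))
  | app _ _ ih₁ ih₂ => exact fun c => .app (ih₁ c) (ih₂ c)
  | ofBag _ ih => exact fun c => .ofBag (ih c)
  | cons _ _ ih₁ ih₂ => exact fun c => .cons (ih₁ c) (ih₂ c)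
  | swap v w b => exact fun c => .swap _ _ _

end PreRes

/-- Resource expressions of each category: `Res .val` is the set of resource values
`v ::= x ∣ λx.t`, and `Res .sim` the set of simple terms `t ::= t t ∣ [v₁, …, vₖ]`, `k ≥ 0`,
where `[v₁, …, vₖ]` is a multiset. -/
def Res (s : RSort) : Type := Quotient (PreRes.setoid s)

namespace Res

def var (n : ℕ) : Res .val := Quotient.mk _ (PreRes.var n)

def lam : Res .sim → Res .val :=
  Quotient.map PreRes.lam fun _ _ h => PreRes.Equiv.lam h

def app : Res .sim → Res .sim → Res .sim :=
  Quotient.map₂ PreRes.app fun _ _ h₁ _ _ h₂ => PreRes.Equiv.app h₁ h₂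

def ofBag : Res .bag → Res .sim :=
  Quotient.map PreRes.ofBag fun _ _ h => PreRes.Equiv.ofBag h

def nil : Res .bag := Quotient.mk _ PreRes.nil

def cons : Res .val → Res .bag → Res .bag :=
  Quotient.map₂ PreRes.cons fun _ _ h₁ _ _ h₂ => PreRes.Equiv.cons h₁ h₂

instance : LeftCommutative cons where
  left_comm v w b := by
    induction v using Quotient.ind
    induction w using Quotient.ind
    induction b using Quotient.ind
    exact Quotient.sound (PreRes.Equiv.swap _ _ _)

/-- The simple term `[v₁, …, vₖ]` determined by a finite multiset of resource values. -/
def bag (m : Multiset (Res .val)) : Res .sim := ofBag (m.foldr cons nil)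

/-- Insert a fresh variable at index `c`: every free index `≥ c` is incremented. -/
def shift {s : RSort} (c : ℕ) : Res s → Res s :=
  Quotient.map (PreRes.shift c) fun _ _ h => PreRes.shift_equiv h c

/-- `LSubst k [v₁, …, vₙ] e e'`: the term `e'` is obtained from `e` by replacing the free
occurrences of the variable `k` by `v₁, …, vₙ`, in some order, each `vᵢ` being used exactly once
(and `k` disappears, so that greater indices are decremented). Hence
`{e' | LSubst k [v₁, …, vₙ] e e'}` is the linear substitution of `v₁, …, vₙ` for `k` in `e`; it is
empty when `n` is not the number of free occurrences of `k` in `e`. -/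
inductive LSubst : {s : RSort} → ℕ → Multiset (Res .val) → Res s → Res s → Prop
  | var_eq (k : ℕ) (v : Res .val) : LSubst k {v} (var k) v
  | var_lt {k n : ℕ} : n < k → LSubst k 0 (var n) (var n)
  | var_gt {k n : ℕ} : k < n → LSubst k 0 (var n) (var (n - 1))
  | lam {k : ℕ} {vs : Multiset (Res .val)} {t t' : Res .sim} :
      LSubst (k + 1) (vs.map (shift 0)) t t' → LSubst k vs (lam t) (lam t')
  | app {k : ℕ} {vs ws : Multiset (Res .val)} {s s' t t' : Res .sim} :
      LSubst k vs s s' → LSubst k ws t t' → LSubst k (vs + ws) (app s t) (app s' t')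
  | bag_nil (k : ℕ) : LSubst k 0 (bag 0) (bag 0)
  | bag_cons {k : ℕ} {vs ws : Multiset (Res .val)} {v v' : Res .val}
      {m m' : Multiset (Res .val)} :
      LSubst k vs v v' → LSubst k ws (bag m) (bag m') →
        LSubst k (vs + ws) (bag (v ::ₘ m)) (bag (v' ::ₘ m'))

/-- `e →_r E` for a single resource expression `e`: the rules `(β_r)`, `(0)`, `(σ₁)`, `(σ₃)` and
their closure under the (multilinear) constructors. -/
inductive Step : {s : RSort} → Res s → Set (Res s) → Prop
  | beta (t : Res .sim) (vs : Multiset (Res .val)) :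
      Step (app (bag {lam t}) (bag vs)) {t' | LSubst 0 vs t t'}
  | zero (vs : Multiset (Res .val)) (t : Res .sim) :
      Multiset.card vs ≠ 1 → Step (app (bag vs) t) ∅
  | sigma1 (t s₁ s₂ : Res .sim) :
      Step (app (app (bag {lam t}) s₁) s₂) {app (bag {lam (app t (shift 0 s₂))}) s₁}
  | sigma3 (v : Res .val) (t s : Res .sim) :
      Step (app (bag {v}) (app (bag {lam t}) s)) {app (bag {lam (app (bag {shift 0 v}) t)}) s}
  | lam {t : Res .sim} {T : Set (Res .sim)} : Step t T → Step (lam t) (lam '' T)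
  | appL {s : Res .sim} {S : Set (Res .sim)} (t : Res .sim) :
      Step s S → Step (app s t) ((fun s' => app s' t) '' S)
  | appR (s : Res .sim) {t : Res .sim} {T : Set (Res .sim)} :
      Step t T → Step (app s t) ((fun t' => app s t') '' T)
  | bag {v : Res .val} {V : Set (Res .val)} (m : Multiset (Res .val)) :
      Step v V → Step (bag (v ::ₘ m)) ((fun v' => bag (v' ::ₘ m)) '' V)

/-- `→_r` on sets: one element is reduced, the other elements are kept. (Finite sets only reduce to
finite sets, and only reductions out of singletons matter below.) -/
inductive SetStep {s : RSort} : Set (Res s) → Set (Res s) → Prop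
  | mk {e : Res s} {E₁ E₂ : Set (Res s)} :
      Step e E₁ → e ∉ E₂ → SetStep ({e} ∪ E₂) (E₁ ∪ E₂)

/-- `F` is an `r`-normal form of `E`: `E` reduces to `F`, and `F` does not reduce. -/
def IsNormalFormOf {s : RSort} (F E : Set (Res s)) : Prop :=
  Relation.ReflTransGen SetStep E F ∧ ¬ ∃ F' : Set (Res s), SetStep F F'

/-- `NF(E) = ⋃_{e ∈ E} nf_r(e)`, where `nf_r(e)` is the normal form of `{e}`. -/
def NF {s : RSort} (E : Set (Res s)) : Set (Res s) :=
  {a | ∃ e ∈ E, ∃ F : Set (Res s), IsNormalFormOf F {e} ∧ a ∈ F}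

end Res

/-! ### Taylor expansions -/

/-- The Taylor expansion `𝒯(M)` of a `λ`-term. -/
def taylor : Lam → Set (Res .sim)
  | .var x => {t | ∃ n : ℕ, t = Res.bag (Multiset.replicate n (Res.var x))}
  | .lam N => {t | ∃ m : Multiset (Res .sim), (∀ u ∈ m, u ∈ taylor N) ∧ t = Res.bag (m.map Res.lam)}
  | .app P Q => {t | ∃ s ∈ taylor P, ∃ u ∈ taylor Q, t = Res.app s u}

/-- The normalized Taylor expansion of an approximant. In an application the leftmost variable `x`
of `x B A₁ ⋯ Aₖ` contributes exactly `[x]` and the abstraction of `(λx.A)(y B A₁ ⋯ Aₖ)` exactly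
one resource `[λx.s]`; the last clause adds the argument `Aₖ`, `k ≥ 1`, to `x B A₁ ⋯ Aₖ₋₁`.
(Only the values at approximants are meaningful.) -/
def tenTerm : LamBot → Set (Res .sim)
  | .bot => {Res.bag 0}
  | .var x => {t | ∃ n : ℕ, t = Res.bag (Multiset.replicate n (Res.var x))}
  | .lam A =>
      {t | ∃ m : Multiset (Res .sim), (∀ u ∈ m, u ∈ tenTerm A) ∧ t = Res.bag (m.map Res.lam)}
  | .app (.var x) B => {t | ∃ u ∈ tenTerm B, t = Res.app (Res.bag {Res.var x}) u}
  | .app (.lam A) N =>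
      {t | ∃ s ∈ tenTerm A, ∃ u ∈ tenTerm N, t = Res.app (Res.bag {Res.lam s}) u}
  | .app P A => {t | ∃ s ∈ tenTerm P, ∃ u ∈ tenTerm A, t = Res.app s u}

/-- The normalized Taylor expansion of a Böhm tree: the union of the normalized Taylor expansions
of its finite approximants. -/
def ten (T : LowerSet Approximant) : Set (Res .sim) := ⋃ A ∈ T, tenTerm A.1

end CbV

namespace CbV

-- Both sides consist of the normal resource terms that occur in the Taylor expansion of some
-- `v`-reduct of `M`; each inclusion factors through this description. The rewriting of sets is
-- first reduced to single terms: resource reduction terminates (size, then depth of applications)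
-- with finite reducts, and a set step never discards a normal element. Hence `NF E` consists of the
-- normal terms reachable from elements of `E` (`Res.mem_NF_iff`), and confluence of the resource
-- calculus is not needed.
--
-- From right to left, a resource step cannot be followed by steps of `M` acting on whole bags,
-- since one element of a bag is reduced at a time. The relation `Approx` therefore lets each
-- resource follow its own reduct of the subterm it comes from; it contains the Taylor expansion and
-- is stable under resource reduction. At a normal term the choices can be unified: `v`-reduction is
-- confluent (`Lam.Steps.confluent`), and normal elements of a Taylor expansion survive reduction of
-- the `λ`-term, because a redex of `M` either shows up as a redex of the resource term or lies
-- under an empty bag. So a reachable normal term lies in `taylor N` for one reduct `N`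
-- (`Approx.exists_mem_taylor`). Cutting from `N` the abstractions whose bodies have no approximant
-- then gives an approximant whose expansion contains that term (`mem_tenTerm_cut`).
--
-- From left to right, the expansion of an approximant below `N` consists of normal terms of `taylor
-- N`. These have exactly one resource in each bag in head position, by rule `(0)`; terms with this
-- linearity property (`linTaylor`) can be pulled back along each `v`-step, giving an element of
-- `taylor M` that reduces to the given one (`Lam.Step.exists_esteps`).

open Relation in
theorem star_lift {α β : Type*} {r : α → α → Prop} {p : β → β → Prop} (f : α → β)
    (h : ∀ {a b}, r a b → p (f a) (f b)) {a b : α} (hab : ReflTransGen r a b) :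
    ReflTransGen p (f a) (f b) :=
  ReflTransGen.lift f (fun _ _ => h) _ _ hab

open Relation in
theorem star_mono {α : Type*} {r p : α → α → Prop} (h : ∀ {a b}, r a b → p a b) {a b : α}
    (hab : ReflTransGen r a b) : ReflTransGen p a b :=
  star_lift id h hab

namespace Lam

/-! ### De Bruijn identities -/

theorem shift_shift (M : Lam) : ∀ {i j : ℕ}, i ≤ j →
    shift (j + 1) (shift i M) = shift i (shift j M) := by
  induction M with
  | var n => intro i j h; simp only [shift]; congr 1; grind
  | lam M ih => intro i j h; simp only [shift]; rw [ih (by omega)]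
  | app M N ihM ihN => intro i j h; simp only [shift]; rw [ihM h, ihN h]

theorem subst_shift (M : Lam) : ∀ (k : ℕ) (V : Lam), subst k V (shift k M) = M := by
  induction M with
  | var n => intro k V; simp only [shift, subst]; grind
  | lam M ih => intro k V; simp only [shift, subst, ih]
  | app M N ihM ihN => intro k V; simp only [shift, subst, ihM, ihN]

theorem shift_subst_of_le (M : Lam) : ∀ {c k : ℕ} (V : Lam), c ≤ k →
    shift c (subst k V M) = subst (k + 1) (shift c V) (shift c M) := by
  induction M with
  | var n => intro c k V h; simp only [shift, subst]; grind [shift]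
  | lam M ih =>
    intro c k V h; simp only [shift, subst]
    rw [ih _ (by omega), shift_shift _ (Nat.zero_le c)]
  | app M N ihM ihN => intro c k V h; simp only [shift, subst]; rw [ihM _ h, ihN _ h]

theorem shift_subst_of_ge (M : Lam) : ∀ {c k : ℕ} (V : Lam), k ≤ c →
    shift c (subst k V M) = subst k (shift c V) (shift (c + 1) M) := by
  induction M with
  | var n => intro c k V h; simp only [shift, subst]; grind [shift]
  | lam M ih =>
    intro c k V h; simp only [shift, subst]
    rw [ih _ (by omega), shift_shift _ (Nat.zero_le c)]
  | app M N ihM ihN => intro c k V h; simp only [shift, subst]; rw [ihM _ h, ihN _ h]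

theorem subst_subst (M : Lam) : ∀ {i k : ℕ} (V W : Lam), i ≤ k →
    subst k V (subst i W M) = subst i (subst k V W) (subst (k + 1) (shift i V) M) := by
  induction M with
  | var n =>
    intro i k V W h
    rcases lt_trichotomy n i with h' | h' | h'
    · simp [subst, h', h'.ne, (h'.trans_le h).ne, h'.trans_le h, show n ≠ k + 1 by omega,
        show n < k + 1 by omega]
    · subst h'
      simp [subst, show n ≠ k + 1 by omega, show n < k + 1 by omega]
    · rcases lt_trichotomy n (k + 1) with h'' | h'' | h''
      · simp [subst, h'.ne', h'.not_gt, show n - 1 ≠ k by omega, show n - 1 < k by omega, h'', h''.ne]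
      · subst h''
        simp [subst, h'.ne', h'.not_gt, subst_shift]
      · simp [subst, h'.ne', h'.not_gt, h''.ne', h''.not_gt, show n - 1 ≠ k by omega,
          show ¬ n - 1 < k by omega, show n - 1 ≠ i by omega, show ¬ n - 1 < i by omega]
  | lam M ih =>
    intro i k V W h; simp only [subst]
    rw [ih _ _ (by omega), shift_shift _ (Nat.zero_le i), shift_subst_of_le _ _ (Nat.zero_le k)]
  | app M N ihM ihN => intro i k V W h; simp only [subst]; rw [ihM _ _ h, ihN _ _ h]

theorem IsValue.shift {V : Lam} (h : IsValue V) (c : ℕ) : IsValue (V.shift c) := by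
  cases h <;> constructor

theorem IsValue.subst {V M : Lam} (h : IsValue M) (hV : IsValue V) (k : ℕ) :
    IsValue (Lam.subst k V M) := by
  cases h with
  | var n =>
    simp only [Lam.subst]
    split_ifs
    · exact hV
    · constructor
    · constructor
  | lam => constructor

theorem not_isValue_app {M N : Lam} : ¬ IsValue (app M N) := nofun

/-! ### Contextual closure -/

/-- The contextual closure of a relation on `λ`-terms. -/
inductive Ctx (R : Lam → Lam → Prop) : Lam → Lam → Prop
  | root {M N : Lam} : R M N → Ctx R M N
  | lam {M N : Lam} : Ctx R M N → Ctx R (lam M) (lam N)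
  | appL {M N : Lam} (P : Lam) : Ctx R M N → Ctx R (app M P) (app N P)
  | appR (P : Lam) {M N : Lam} : Ctx R M N → Ctx R (app P M) (app P N)

/-- The rule `β_v`. -/
inductive BetaRule : Lam → Lam → Prop
  | mk (M V : Lam) : IsValue V → BetaRule (app (lam M) V) (subst 0 V M)

/-- The rules `σ₁` and `σ₃`. -/
inductive SigmaRule : Lam → Lam → Prop
  | sigma1 (M N P : Lam) :
      SigmaRule (app (app (lam M) N) P) (app (lam (app M (shift 0 P))) N)
  | sigma3 (V M N : Lam) : IsValue V →
      SigmaRule (app V (app (lam M) N)) (app (lam (app (shift 0 V) M)) N)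

abbrev Beta := Ctx BetaRule
abbrev Sigma := Ctx SigmaRule

open Relation

section Ctx
variable {R : Lam → Lam → Prop}

theorem Ctx.isValue {M N : Lam} (hR : ∀ {M N}, R M N → ¬ IsValue M) (h : Ctx R M N)
    (hM : IsValue M) : IsValue N := by
  cases h with
  | root h => exact absurd hM (hR h)
  | lam => constructor
  | appL => cases hM
  | appR => cases hM

theorem Ctx.shift (hR : ∀ {M N} (c : ℕ), R M N → R (M.shift c) (N.shift c)) {M N : Lam}
    (h : Ctx R M N) : ∀ c : ℕ, Ctx R (M.shift c) (N.shift c) := by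
  induction h with
  | root h => exact fun c => .root (hR c h)
  | lam _ ih => exact fun c => .lam (ih (c + 1))
  | appL P _ ih => exact fun c => .appL _ (ih c)
  | appR P _ ih => exact fun c => .appR _ (ih c)

theorem Ctx.subst
    (hR : ∀ {M N V} (k : ℕ), IsValue V → R M N → R (Lam.subst k V M) (Lam.subst k V N)) {M N : Lam}
    (h : Ctx R M N) : ∀ (k : ℕ) {V : Lam}, IsValue V → Ctx R (Lam.subst k V M) (Lam.subst k V N) := by
  induction h with
  | root h => exact fun k V hV => .root (hR k hV h)
  | lam _ ih => exact fun k V hV => .lam (ih (k + 1) (hV.shift 0))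
  | appL P _ ih => exact fun k V hV => .appL _ (ih k hV)
  | appR P _ ih => exact fun k V hV => .appR _ (ih k hV)

theorem ctx_lam_star {M N : Lam} (h : ReflTransGen (Ctx R) M N) :
    ReflTransGen (Ctx R) (lam M) (lam N) :=
  star_lift lam .lam h

theorem ctx_app_star {M N P Q : Lam} (h : ReflTransGen (Ctx R) M N)
    (h' : ReflTransGen (Ctx R) P Q) : ReflTransGen (Ctx R) (app M P) (app N Q) :=
  (star_lift (app · P) (.appL P) h).trans (star_lift (app N ·) (.appR N) h')

/-- The substituted term is copied to every occurrence of `k`, hence as many steps as occurrences.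
-/
theorem ctx_subst_right_star
    (hR : ∀ {M N} (c : ℕ), R M N → R (M.shift c) (N.shift c)) (M : Lam) :
    ∀ (k : ℕ) {V W : Lam}, Ctx R V W →
      ReflTransGen (Ctx R) (Lam.subst k V M) (Lam.subst k W M) := by
  induction M with
  | var n =>
    intro k V W h
    simp only [Lam.subst]
    split_ifs
    · exact .single h
    · exact .refl
    · exact .refl
  | lam M ih => exact fun k V W h => ctx_lam_star (ih _ (h.shift hR 0))
  | app M N ihM ihN => exact fun k V W h => ctx_app_star (ihM k h) (ihN k h)

end Ctx

theorem BetaRule.not_isValue {M N : Lam} (h : BetaRule M N) : ¬ IsValue M := by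
  cases h; exact not_isValue_app

theorem SigmaRule.not_isValue {M N : Lam} (h : SigmaRule M N) : ¬ IsValue M := by
  cases h <;> exact not_isValue_app

theorem BetaRule.shift {M N : Lam} (c : ℕ) (h : BetaRule M N) :
    BetaRule (M.shift c) (N.shift c) := by
  obtain ⟨M, V, hV⟩ := h
  rw [shift_subst_of_ge _ _ (Nat.zero_le c)]
  exact .mk _ _ (hV.shift c)

theorem BetaRule.subst {M N V : Lam} (k : ℕ) (hV : IsValue V) (h : BetaRule M N) :
    BetaRule (Lam.subst k V M) (Lam.subst k V N) := by
  obtain ⟨M, W, hW⟩ := h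
  rw [subst_subst _ _ _ (Nat.zero_le k)]
  exact .mk _ _ (hW.subst hV k)

theorem SigmaRule.shift {M N : Lam} (c : ℕ) (h : SigmaRule M N) :
    SigmaRule (M.shift c) (N.shift c) := by
  cases h with
  | sigma1 M N P =>
    simp only [Lam.shift]
    rw [shift_shift _ (Nat.zero_le c)]
    exact .sigma1 _ _ _
  | sigma3 V M N hV =>
    simp only [Lam.shift]
    rw [shift_shift _ (Nat.zero_le c)]
    exact .sigma3 _ _ _ (hV.shift c)

theorem SigmaRule.subst {M N V : Lam} (k : ℕ) (hV : IsValue V) (h : SigmaRule M N) :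
    SigmaRule (Lam.subst k V M) (Lam.subst k V N) := by
  cases h with
  | sigma1 M N P =>
    simp only [Lam.subst]
    rw [← shift_subst_of_le _ _ (Nat.zero_le k)]
    exact .sigma1 _ _ _
  | sigma3 W M N hW =>
    simp only [Lam.subst]
    rw [← shift_subst_of_le _ _ (Nat.zero_le k)]
    exact .sigma3 _ _ _ (hW.subst hV k)

/-- The two kinds of step call for different confluence arguments: parallel reduction for `β_v`,
termination for `σ`. -/
theorem step_iff {M N : Lam} : Step M N ↔ Beta M N ∨ Sigma M N := by
  constructor
  · intro h
    induction h with
    | beta M V hV => exact .inl (.root (.mk M V hV))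
    | sigma1 M N P => exact .inr (.root (.sigma1 M N P))
    | sigma3 V M N hV => exact .inr (.root (.sigma3 V M N hV))
    | lam _ ih => exact ih.imp .lam .lam
    | appL P _ ih => exact ih.imp (.appL P) (.appL P)
    | appR P _ ih => exact ih.imp (.appR P) (.appR P)
  · rintro (h | h)
    · induction h with
      | root h => obtain ⟨M, V, hV⟩ := h; exact .beta M V hV
      | lam _ ih => exact .lam ih
      | appL P _ ih => exact .appL P ih
      | appR P _ ih => exact .appR P ih
    · induction h with
      | root h =>
        cases h with
        | sigma1 M N P => exact .sigma1 M N P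
        | sigma3 V M N hV => exact .sigma3 V M N hV
      | lam _ ih => exact .lam ih
      | appL P _ ih => exact .appL P ih
      | appR P _ ih => exact .appR P ih

theorem Step.shift {M N : Lam} (h : Step M N) (c : ℕ) : Step (M.shift c) (N.shift c) :=
  step_iff.2 ((step_iff.1 h).imp (fun h => Ctx.shift BetaRule.shift h c)
    (fun h => Ctx.shift SigmaRule.shift h c))

theorem Step.subst {M N V : Lam} (h : Step M N) (k : ℕ) (hV : IsValue V) :
    Step (Lam.subst k V M) (Lam.subst k V N) :=
  step_iff.2 ((step_iff.1 h).imp (fun h => Ctx.subst BetaRule.subst h k hV)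
    (fun h => Ctx.subst SigmaRule.subst h k hV))

theorem Step.isValue {M N : Lam} (h : Step M N) (hM : IsValue M) : IsValue N :=
  (step_iff.1 h).elim (fun h => Ctx.isValue BetaRule.not_isValue h hM)
    (fun h => Ctx.isValue SigmaRule.not_isValue h hM)

theorem Steps.trans {M N P : Lam} (h : Steps M N) (h' : Steps N P) : Steps M P :=
  ReflTransGen.trans h h'

theorem Steps.shift {M N : Lam} (h : Steps M N) (c : ℕ) : Steps (M.shift c) (N.shift c) :=
  star_lift (Lam.shift c) (fun h => Step.shift h c) h

theorem Steps.subst {M N V : Lam} (h : Steps M N) (k : ℕ) (hV : IsValue V) :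
    Steps (Lam.subst k V M) (Lam.subst k V N) :=
  star_lift (Lam.subst k V) (fun h => Step.subst h k hV) h

theorem Steps.isValue {M N : Lam} (h : Steps M N) (hM : IsValue M) : IsValue N := by
  induction h with
  | refl => exact hM
  | tail _ h ih => exact h.isValue ih

theorem Steps.lam {M N : Lam} (h : Steps M N) : Steps (lam M) (lam N) :=
  star_lift Lam.lam .lam h

theorem Steps.app {M N P Q : Lam} (h : Steps M N) (h' : Steps P Q) :
    Steps (app M P) (app N Q) :=
  (star_lift (Lam.app · P) (.appL P) h).trans (star_lift (Lam.app N ·) (.appR N) h')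

/-! ### Confluence of `β_v` -/

/-- Parallel `β_v`-reduction. -/
inductive Par : Lam → Lam → Prop
  | var (n : ℕ) : Par (var n) (var n)
  | lam {M M' : Lam} : Par M M' → Par (lam M) (lam M')
  | app {M M' N N' : Lam} : Par M M' → Par N N' → Par (app M N) (app M' N')
  | beta {M M' V V' : Lam} : IsValue V → Par M M' → Par V V' →
      Par (app (lam M) V) (subst 0 V' M')

theorem Par.refl : ∀ M : Lam, Par M M
  | .var n => .var n
  | .lam M => .lam (refl M)
  | .app M N => .app (refl M) (refl N)

theorem Par.isValue {M N : Lam} (h : Par M N) (hM : IsValue M) : IsValue N := by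
  cases h with
  | app => cases hM
  | beta => cases hM
  | _ => constructor

theorem Par.shift {M N : Lam} (h : Par M N) : ∀ c : ℕ, Par (M.shift c) (N.shift c) := by
  induction h with
  | var n => exact fun c => .var _
  | lam _ ih => exact fun c => .lam (ih _)
  | app _ _ ih ih' => exact fun c => .app (ih c) (ih' c)
  | beta hV _ _ ih ih' =>
    intro c
    rw [shift_subst_of_ge _ _ (Nat.zero_le c)]
    exact .beta (hV.shift c) (ih _) (ih' c)

theorem Par.subst {M N : Lam} (h : Par M N) :
    ∀ (k : ℕ) {V W : Lam}, IsValue V → Par V W → Par (Lam.subst k V M) (Lam.subst k W N) := by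
  induction h with
  | var n =>
    intro k V W _ h
    simp only [Lam.subst]
    split_ifs
    · exact h
    · exact .var _
    · exact .var _
  | lam _ ih => exact fun k V W hV h => .lam (ih _ (hV.shift 0) (h.shift 0))
  | app _ _ ih ih' => exact fun k V W hV h => .app (ih k hV h) (ih' k hV h)
  | beta hU _ _ ih ih' =>
    intro k V W hV h
    rw [subst_subst _ _ _ (Nat.zero_le k)]
    exact .beta (hU.subst hV k) (ih _ (hV.shift 0) (h.shift 0)) (ih' k hV h)

/-- When only one side contracts a given redex, the other still can, because parallel reduction
preserves abstractions and values; `Par.subst` closes the diagram. -/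
theorem Par.diamond {M N : Lam} (h : Par M N) : ∀ {P : Lam}, Par M P → ∃ Q, Par N Q ∧ Par P Q := by
  induction h with
  | var n => intro P h; exact ⟨P, h, .refl P⟩
  | lam _ ih =>
    intro P h
    cases h with
    | lam h => obtain ⟨Q, h₁, h₂⟩ := ih h; exact ⟨_, .lam h₁, .lam h₂⟩
  | app hM hN ihM ihN =>
    intro P h
    cases h with
    | app h h' =>
      obtain ⟨Q, h₁, h₂⟩ := ihM h
      obtain ⟨Q', h₁', h₂'⟩ := ihN h'
      exact ⟨_, .app h₁ h₁', .app h₂ h₂'⟩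
    | beta hV h h' =>
      obtain ⟨Q, h₁, h₂⟩ := ihM (.lam h)
      obtain ⟨Q', h₁', h₂'⟩ := ihN h'
      cases hM with
      | lam hM =>
        cases h₁ with
        | lam h₁ =>
          cases h₂ with
          | lam h₂ =>
            exact ⟨_, .beta (hN.isValue hV) h₁ h₁', h₂.subst 0 (h'.isValue hV) h₂'⟩
  | beta hV hM hN ihM ihN =>
    intro P h
    cases h with
    | app h h' =>
      cases h with
      | lam h =>
        obtain ⟨Q, h₁, h₂⟩ := ihM h
        obtain ⟨Q', h₁', h₂'⟩ := ihN h'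
        exact ⟨_, h₁.subst 0 (hN.isValue hV) h₁', .beta (h'.isValue hV) h₂ h₂'⟩
    | beta _ h h' =>
      obtain ⟨Q, h₁, h₂⟩ := ihM h
      obtain ⟨Q', h₁', h₂'⟩ := ihN h'
      exact ⟨_, h₁.subst 0 (hN.isValue hV) h₁', h₂.subst 0 (h'.isValue hV) h₂'⟩

theorem Beta.par {M N : Lam} (h : Beta M N) : Par M N := by
  induction h with
  | root h => obtain ⟨M, V, hV⟩ := h; exact .beta hV (.refl M) (.refl V)
  | lam _ ih => exact .lam ih
  | appL P _ ih => exact .app ih (.refl P)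
  | appR P _ ih => exact .app (.refl P) ih

theorem Par.beta_star {M N : Lam} (h : Par M N) : ReflTransGen Beta M N := by
  induction h with
  | var n => exact .refl
  | lam _ ih => exact ctx_lam_star ih
  | app _ _ ih ih' => exact ctx_app_star ih ih'
  | beta hV _ hV' ih ih' =>
    exact (ctx_app_star (ctx_lam_star ih) ih').tail (.root (.mk _ _ (hV'.isValue hV)))

theorem beta_confluent {M N P : Lam} (h : ReflTransGen Beta M N) (h' : ReflTransGen Beta M P) :
    ∃ Q, ReflTransGen Beta N Q ∧ ReflTransGen Beta P Q := by
  have key : ∀ {M N}, ReflTransGen Par M N → ReflTransGen Beta M N := fun h => by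
    induction h with
    | refl => exact .refl
    | tail _ h ih => exact ih.trans h.beta_star
  obtain ⟨Q, h₁, h₂⟩ := church_rosser
    (fun a b c (h : Par a b) (h' : Par a c) =>
      let ⟨d, h₁, h₂⟩ := h.diamond h'
      ⟨d, .single h₁, .single h₂⟩)
    (star_mono Beta.par h) (star_mono Beta.par h')
  exact ⟨Q, key h₁, key h₂⟩

/-! ### Confluence of `σ` -/

/-- The number of applications in a term. -/
def apps : Lam → ℕ
  | var _ => 0
  | lam M => apps M
  | app M N => apps M + apps N + 1

/-- The number of applications in a term which is not a value. -/
def headApps : Lam → ℕ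
  | app M N => apps (app M N)
  | _ => 0

/-- The sum, over all applications, of their depths; the body of the abstraction in
`(λx.M)N` is considered as deep as the whole application. -/
def depthSum : Lam → ℕ
  | var _ => 0
  | lam M => depthSum M
  | app M N => depthSum M + depthSum N + headApps M + apps N

theorem headApps_app (M N : Lam) : headApps (app M N) = apps M + apps N + 1 := rfl

theorem headApps_lam (M : Lam) : headApps (lam M) = 0 := rfl

theorem apps_shift (M : Lam) : ∀ c, apps (shift c M) = apps M := by
  induction M <;> simp_all [shift, apps]

theorem headApps_shift (M : Lam) (c : ℕ) : headApps (shift c M) = headApps M := by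
  cases M <;> simp [shift, headApps, apps, apps_shift]

theorem depthSum_shift (M : Lam) : ∀ c, depthSum (shift c M) = depthSum M := by
  induction M <;> simp_all [shift, depthSum, apps_shift, headApps_shift]

theorem headApps_le (M : Lam) : headApps M ≤ apps M := by
  cases M <;> simp [headApps]

theorem IsValue.headApps {V : Lam} (h : IsValue V) : headApps V = 0 := by
  cases h <;> rfl

theorem Sigma.apps_eq {M N : Lam} (h : Sigma M N) : apps N = apps M := by
  induction h with
  | root h => cases h <;> simp [apps, apps_shift] <;> omega
  | _ => simp_all [apps]

theorem Sigma.headApps_eq {M N : Lam} (h : Sigma M N) : Lam.headApps N = Lam.headApps M := by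
  have := Sigma.apps_eq h
  cases h with
  | root h => cases h <;> exact this
  | lam => rfl
  | _ => exact this

/-- A `σ`-step brings `(λx.M)N` to the root. Its parts lose the depth due to the enclosing
application, and passing into the body of a head abstraction costs nothing. Invariance of `apps` and
`headApps` carries the decrease through contexts. -/
theorem Sigma.depthSum_lt {M N : Lam} (h : Sigma M N) : depthSum N < depthSum M := by
  induction h with
  | root h =>
    cases h with
    | sigma1 M N P =>
      have := headApps_le M
      simp only [depthSum, apps, headApps_app, headApps_lam, apps_shift, depthSum_shift]
      omega
    | sigma3 V M N hV =>
      simp only [depthSum, apps, headApps_shift, hV.headApps, headApps_lam, depthSum_shift]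
      omega
  | lam _ ih => exact ih
  | appL P h ih => simp only [depthSum, Sigma.headApps_eq h]; omega
  | appR P h ih => simp only [depthSum, Sigma.apps_eq h]; omega

theorem sigmaRule_local_confluent {M N P : Lam} (h : SigmaRule M N) (h' : Sigma M P) :
    ∃ Q, ReflTransGen Sigma N Q ∧ ReflTransGen Sigma P Q := by
  cases h with
  | sigma1 M N P =>
    cases h' with
    | root h' =>
      cases h' with
      | sigma1 => exact ⟨_, .refl, .refl⟩
      | sigma3 _ _ _ hV => cases hV
    | appL _ h' =>
      cases h' with
      | root h' =>
        cases h' with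
        -- The critical pair `(λx.M)((λy.M')N')P`: both sides reach `(λy.(λx.MP)M')N'`.
        | sigma3 _ M' N' _ =>
          refine ⟨_, .single (.root (.sigma3 _ _ _ (.lam _))),
            .head (.root (.sigma1 _ _ _)) (.single (.appL _ (.lam ?_)))⟩
          simp only [Lam.shift]
          rw [shift_shift _ (Nat.zero_le 0)]
          exact .root (.sigma1 _ _ _)
      | appL _ h' =>
        cases h' with
        | root h' => cases h'
        | lam h' =>
          exact ⟨_, .single (.appL _ (.lam (.appL _ h'))), .single (.root (.sigma1 _ _ _))⟩
      | appR _ h' => exact ⟨_, .single (.appR _ h'), .single (.root (.sigma1 _ _ _))⟩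
    | appR _ h' =>
      exact ⟨_, .single (.appL _ (.lam (.appR _ (Ctx.shift SigmaRule.shift h' 0)))),
        .single (.root (.sigma1 _ _ _))⟩
  | sigma3 V M N hV =>
    cases h' with
    | root h' =>
      cases h' with
      | sigma1 => cases hV
      | sigma3 => exact ⟨_, .refl, .refl⟩
    | appL _ h' =>
      exact ⟨_, .single (.appL _ (.lam (.appL _ (Ctx.shift SigmaRule.shift h' 0)))),
        .single (.root (.sigma3 _ _ _ (Ctx.isValue SigmaRule.not_isValue h' hV)))⟩
    | appR _ h' =>
      cases h' with
      | root h' =>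
        cases h' with
        -- The critical pair `V((λx.M)((λy.M')N'))`: both sides reach `(λy.(λx.VM)M')N'`.
        | sigma3 _ M' N' _ =>
          refine ⟨_, .single (.root (.sigma3 _ _ _ (.lam _))),
            .head (.root (.sigma3 _ _ _ hV)) (.single (.appL _ (.lam ?_)))⟩
          simp only [Lam.shift]
          rw [shift_shift _ (Nat.zero_le 0)]
          exact .root (.sigma3 _ _ _ (hV.shift 0))
      | appL _ h' =>
        cases h' with
        | root h' => cases h'
        | lam h' =>
          exact ⟨_, .single (.appL _ (.lam (.appR _ h'))), .single (.root (.sigma3 _ _ _ hV))⟩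
      | appR _ h' => exact ⟨_, .single (.appR _ h'), .single (.root (.sigma3 _ _ _ hV))⟩

theorem sigma_local_confluent {M N : Lam} (h : Sigma M N) : ∀ {P : Lam}, Sigma M P →
    ∃ Q, ReflTransGen Sigma N Q ∧ ReflTransGen Sigma P Q := by
  induction h with
  | root h => exact sigmaRule_local_confluent h
  | lam h ih =>
    intro P h'
    cases h' with
    | root h' => exact (sigmaRule_local_confluent h' (.lam h)).imp fun _ h => h.symm
    | lam h' =>
      obtain ⟨Q, h₁, h₂⟩ := ih h'
      exact ⟨_, ctx_lam_star h₁, ctx_lam_star h₂⟩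
  | appL P h ih =>
    intro P h'
    cases h' with
    | root h' => exact (sigmaRule_local_confluent h' (.appL _ h)).imp fun _ h => h.symm
    | appL _ h' =>
      obtain ⟨Q, h₁, h₂⟩ := ih h'
      exact ⟨_, ctx_app_star h₁ .refl, ctx_app_star h₂ .refl⟩
    | appR _ h' => exact ⟨_, .single (.appR _ h'), .single (.appL _ h)⟩
  | appR P h ih =>
    intro P h'
    cases h' with
    | root h' => exact (sigmaRule_local_confluent h' (.appR _ h)).imp fun _ h => h.symm
    | appL _ h' => exact ⟨_, .single (.appL _ h'), .single (.appR _ h)⟩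
    | appR _ h' =>
      obtain ⟨Q, h₁, h₂⟩ := ih h'
      exact ⟨_, ctx_app_star .refl h₁, ctx_app_star .refl h₂⟩

/-- Newman's lemma, by induction on the decreasing measure. -/
theorem sigma_confluent {M N P : Lam} (h : ReflTransGen Sigma M N) (h' : ReflTransGen Sigma M P) :
    ∃ Q, ReflTransGen Sigma N Q ∧ ReflTransGen Sigma P Q := by
  induction hn : depthSum M using Nat.strong_induction_on generalizing M N P with
  | _ n ih =>
    subst hn
    rcases h.cases_head with rfl | ⟨N₁, h₁, h₂⟩
    · exact ⟨P, h', .refl⟩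
    rcases h'.cases_head with rfl | ⟨P₁, h₁', h₂'⟩
    · exact ⟨N, .refl, h⟩
    obtain ⟨Q, hQ, hQ'⟩ := sigma_local_confluent h₁ h₁'
    obtain ⟨Q₁, hQ₁, hQ₁'⟩ := ih _ (Sigma.depthSum_lt h₁) h₂ hQ rfl
    obtain ⟨Q₂, hQ₂, hQ₂'⟩ := ih _ (Sigma.depthSum_lt h₁') h₂' (hQ'.trans hQ₁') rfl
    exact ⟨Q₂, hQ₁.trans hQ₂', hQ₂⟩

/-! ### Commutation of `β_v` and `σ`, and confluence -/

theorem betaRule_sigma_commute {M N P : Lam} (h : BetaRule M N) (h' : Sigma M P) :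
    ∃ Q, ReflTransGen Sigma N Q ∧ ReflGen Beta P Q := by
  obtain ⟨M, V, hV⟩ := h
  cases h' with
  | root h' =>
    cases h' with
    | sigma3 => cases hV
  | appL _ h' =>
    cases h' with
    | root h' => cases h'
    | lam h' =>
      exact ⟨_, .single (Ctx.subst SigmaRule.subst h' 0 hV), .single (.root (.mk _ _ hV))⟩
  | appR _ h' =>
    exact ⟨_, ctx_subst_right_star SigmaRule.shift M 0 h',
      .single (.root (.mk _ _ (Ctx.isValue SigmaRule.not_isValue h' hV)))⟩

/-- A `σ`-rule neither copies nor erases a `β_v`-redex. If the redex inside the `σ`-redex is itself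
the contracted one, contracting it after the `σ`-step gives the same term at once, since the term
moved under the binder does not contain the variable (`subst_shift`). -/
theorem beta_sigmaRule_commute {M N P : Lam} (h : Beta M N) (h' : SigmaRule M P) :
    ∃ Q, ReflTransGen Sigma N Q ∧ ReflGen Beta P Q := by
  cases h' with
  | sigma1 M N P =>
    cases h with
    | root h => cases h
    | appL _ h =>
      cases h with
      | root h =>
        obtain ⟨_, _, hN⟩ := h
        refine ⟨_, .refl, .single (.root ?_)⟩
        have := BetaRule.mk (app M (Lam.shift 0 P)) N hN
        rwa [Lam.subst, subst_shift] at this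
      | appL _ h =>
        cases h with
        | root h => cases h
        | lam h => exact ⟨_, .single (.root (.sigma1 _ _ _)), .single (.appL _ (.lam (.appL _ h)))⟩
      | appR _ h => exact ⟨_, .single (.root (.sigma1 _ _ _)), .single (.appR _ h)⟩
    | appR _ h =>
      exact ⟨_, .single (.root (.sigma1 _ _ _)),
        .single (.appL _ (.lam (.appR _ (Ctx.shift BetaRule.shift h 0))))⟩
  | sigma3 V M N hV =>
    cases h with
    | root h => obtain ⟨_, _, h⟩ := h; cases h
    | appL _ h =>
      exact ⟨_, .single (.root (.sigma3 _ _ _ (Ctx.isValue BetaRule.not_isValue h hV))),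
        .single (.appL _ (.lam (.appL _ (Ctx.shift BetaRule.shift h 0))))⟩
    | appR _ h =>
      cases h with
      | root h =>
        obtain ⟨_, _, hN⟩ := h
        refine ⟨_, .refl, .single (.root ?_)⟩
        have := BetaRule.mk (app (Lam.shift 0 V) M) N hN
        rwa [Lam.subst, subst_shift] at this
      | appL _ h =>
        cases h with
        | root h => cases h
        | lam h =>
          exact ⟨_, .single (.root (.sigma3 _ _ _ hV)), .single (.appL _ (.lam (.appR _ h)))⟩
      | appR _ h => exact ⟨_, .single (.root (.sigma3 _ _ _ hV)), .single (.appR _ h)⟩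

theorem reflGen_lift {f : Lam → Lam} (hf : ∀ {M N}, Beta M N → Beta (f M) (f N)) {M N : Lam}
    (h : ReflGen Beta M N) : ReflGen Beta (f M) (f N) := by
  cases h with
  | refl => exact .refl
  | single h => exact .single (hf h)

/-- Only `β_v` can duplicate the other redex, so at most one `β_v`-step is needed to close the
diagram. This asymmetry is what lets local diagrams be tiled into full commutation. -/
theorem beta_sigma_strong_commute {M N : Lam} (h : Beta M N) : ∀ {P : Lam}, Sigma M P →
    ∃ Q, ReflTransGen Sigma N Q ∧ ReflGen Beta P Q := by
  induction h with
  | root h => exact betaRule_sigma_commute h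
  | lam h ih =>
    intro P h'
    cases h' with
    | root h' => exact beta_sigmaRule_commute (.lam h) h'
    | lam h' =>
      obtain ⟨Q, h₁, h₂⟩ := ih h'
      exact ⟨_, ctx_lam_star h₁, reflGen_lift .lam h₂⟩
  | appL P h ih =>
    intro P h'
    cases h' with
    | root h' => exact beta_sigmaRule_commute (.appL _ h) h'
    | appL _ h' =>
      obtain ⟨Q, h₁, h₂⟩ := ih h'
      exact ⟨_, ctx_app_star h₁ .refl, reflGen_lift (.appL _) h₂⟩
    | appR _ h' => exact ⟨_, .single (.appR _ h'), .single (.appL _ h)⟩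
  | appR P h ih =>
    intro P h'
    cases h' with
    | root h' => exact beta_sigmaRule_commute (.appR _ h) h'
    | appL _ h' => exact ⟨_, .single (.appL _ h'), .single (.appR _ h)⟩
    | appR _ h' =>
      obtain ⟨Q, h₁, h₂⟩ := ih h'
      exact ⟨_, ctx_app_star .refl h₁, reflGen_lift (.appR _) h₂⟩

theorem beta_sigma_commute {M N P : Lam} (h : ReflTransGen Beta M N)
    (h' : ReflTransGen Sigma M P) : ∃ Q, ReflTransGen Sigma N Q ∧ ReflTransGen Beta P Q := by
  have key : ∀ {M N P : Lam}, Beta M N → ReflTransGen Sigma M P →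
      ∃ Q, ReflTransGen Sigma N Q ∧ ReflGen Beta P Q := by
    intro M N P h h'
    induction h' with
    | refl => exact ⟨N, .refl, .single h⟩
    | tail _ hs ih =>
      obtain ⟨Q, h₁, h₂⟩ := ih
      cases h₂ with
      | refl => exact ⟨_, h₁.tail hs, .refl⟩
      | single h₂ =>
        obtain ⟨Q', h₃, h₄⟩ := beta_sigma_strong_commute h₂ hs
        exact ⟨Q', h₁.trans h₃, h₄⟩
  induction h with
  | refl => exact ⟨P, h', .refl⟩
  | tail _ hs ih =>
    obtain ⟨Q, h₁, h₂⟩ := ih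
    obtain ⟨Q', h₃, h₄⟩ := key hs h₁
    exact ⟨Q', h₃, h₂.trans h₄.to_reflTransGen⟩

/-- The Hindley–Rosen lemma: two confluent relations that commute have a confluent union. -/
theorem Steps.confluent {M N P : Lam} (h : Steps M N) (h' : Steps M P) :
    ∃ Q, Steps N Q ∧ Steps P Q := by
  let R : Lam → Lam → Prop := fun M N => ReflTransGen Beta M N ∨ ReflTransGen Sigma M N
  have hR : ∀ {M N}, Steps M N → ReflTransGen R M N := fun h =>
    star_mono (fun h => (step_iff.1 h).imp .single .single) h
  have hR' : ∀ {M N}, ReflTransGen R M N → Steps M N := fun h => by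
    induction h with
    | refl => exact .refl
    | tail _ h ih =>
      refine ih.trans ?_
      rcases h with h | h
      · exact star_mono (fun h => step_iff.2 (.inl h)) h
      · exact star_mono (fun h => step_iff.2 (.inr h)) h
  obtain ⟨Q, h₁, h₂⟩ := church_rosser (r := R) (fun a b c h h' => by
    suffices ∃ d, R b d ∧ R c d by
      obtain ⟨d, h₁, h₂⟩ := this
      exact ⟨d, .single h₁, .single h₂⟩
    rcases h with h | h <;> rcases h' with h' | h'
    · exact (beta_confluent h h').imp fun _ h => h.imp .inl .inl
    · exact (beta_sigma_commute h h').imp fun _ h => h.imp .inr .inl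
    · exact (beta_sigma_commute h' h).imp fun _ h => ⟨.inl h.2, .inr h.1⟩
    · exact (sigma_confluent h h').imp fun _ h => h.imp .inr .inr) (hR h) (hR h')
  exact ⟨Q, hR' h₁, hR' h₂⟩

end Lam

/-! ### The constructors of resource terms -/

/-- The result of inspecting the outermost constructor of a resource expression. -/
def RView : RSort → Type
  | .val => ℕ ⊕ Res .sim
  | .sim => (Res .sim × Res .sim) ⊕ Multiset (Res .val)
  | .bag => Multiset (Res .val)

namespace PreRes

/-- A bag is unfolded down to its multiset of elements, because its first element is not invariant
under `swap`. Invariance of the view makes the constructors of `Res` injective and disjoint. -/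
def view : {s : RSort} → PreRes s → RView s
  | _, var n => (Sum.inl n : ℕ ⊕ Res .sim)
  | _, lam t => (Sum.inr (Quotient.mk _ t) : ℕ ⊕ Res .sim)
  | _, app t u =>
    (Sum.inl (Quotient.mk _ t, Quotient.mk _ u) : (Res .sim × Res .sim) ⊕ Multiset (Res .val))
  | _, ofBag b => (Sum.inr (view b) : (Res .sim × Res .sim) ⊕ Multiset (Res .val))
  | _, nil => (0 : Multiset (Res .val))
  | _, cons v b => (Multiset.cons (Quotient.mk _ v : Res .val) (view b) : Multiset (Res .val))

theorem view_equiv {s : RSort} {e f : PreRes s} (h : Equiv e f) : view e = view f := by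
  induction h with
  | refl e => rfl
  | symm _ ih => exact ih.symm
  | trans _ _ ih₁ ih₂ => exact ih₁.trans ih₂
  | lam h => exact congrArg Sum.inr (Quotient.sound h)
  | app h₁ h₂ =>
    exact congrArg Sum.inl (Prod.ext (Quotient.sound h₁) (Quotient.sound h₂))
  | ofBag _ ih => exact congrArg Sum.inr ih
  | cons h _ _ ih => exact congrArg₂ Multiset.cons (Quotient.sound h) ih
  | swap v w b => exact Multiset.cons_swap _ _ _

/-- The number of variable occurrences, abstractions and applications. -/
def size : {s : RSort} → PreRes s → ℕ
  | _, var _ => 1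
  | _, lam t => size t + 1
  | _, app t u => size t + size u + 1
  | _, ofBag b => size b
  | _, nil => 0
  | _, cons v b => size v + size b

/-- The number of applications. -/
def apps : {s : RSort} → PreRes s → ℕ
  | _, var _ => 0
  | _, lam t => apps t
  | _, app t u => apps t + apps u + 1
  | _, ofBag b => apps b
  | _, nil => 0
  | _, cons v b => apps v + apps b

/-- The number of applications in an expression which is not a bag. -/
def headApps : {s : RSort} → PreRes s → ℕ
  | _, app t u => apps t + apps u + 1
  | _, _ => 0

/-- The sum, over all applications, of their depths; the content of `b` in an application `b t`
with a bag `b` is considered as deep as the whole application. -/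
def depthSum : {s : RSort} → PreRes s → ℕ
  | _, var _ => 0
  | _, lam t => depthSum t
  | _, app t u => depthSum t + depthSum u + headApps t + apps u
  | _, ofBag b => depthSum b
  | _, nil => 0
  | _, cons v b => depthSum v + depthSum b

theorem size_equiv {s : RSort} {e f : PreRes s} (h : Equiv e f) : size e = size f := by
  induction h with
  | swap => simp only [size]; omega
  | _ => simp_all [size]

theorem apps_equiv {s : RSort} {e f : PreRes s} (h : Equiv e f) : apps e = apps f := by
  induction h with
  | swap => simp only [apps]; omega
  | _ => simp_all [apps]

theorem headApps_equiv {s : RSort} {e f : PreRes s} (h : Equiv e f) :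
    headApps e = headApps f := by
  induction h with
  | app h₁ h₂ => simp only [headApps, apps_equiv h₁, apps_equiv h₂]
  | _ => simp_all [headApps]

theorem depthSum_equiv {s : RSort} {e f : PreRes s} (h : Equiv e f) :
    depthSum e = depthSum f := by
  induction h with
  | app h₁ h₂ ih₁ ih₂ => simp only [depthSum, headApps_equiv h₁, apps_equiv h₂, ih₁, ih₂]
  | swap => simp only [depthSum]; omega
  | _ => simp_all [depthSum]

theorem size_shift {s : RSort} (e : PreRes s) : ∀ c, size (shift c e) = size e := by
  induction e <;> simp_all [size, shift]

theorem apps_shift {s : RSort} (e : PreRes s) : ∀ c, apps (shift c e) = apps e := by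
  induction e <;> simp_all [apps, shift]

theorem headApps_shift {s : RSort} (e : PreRes s) (c : ℕ) : headApps (shift c e) = headApps e := by
  cases e <;> simp [headApps, shift, apps_shift]

theorem depthSum_shift {s : RSort} (e : PreRes s) : ∀ c, depthSum (shift c e) = depthSum e := by
  induction e <;> simp_all [depthSum, shift, apps_shift, headApps_shift]

end PreRes

namespace Res

def view {s : RSort} : Res s → RView s :=
  Quotient.lift PreRes.view fun _ _ h => PreRes.view_equiv h

def size {s : RSort} : Res s → ℕ := Quotient.lift PreRes.size fun _ _ h => PreRes.size_equiv h

def apps {s : RSort} : Res s → ℕ := Quotient.lift PreRes.apps fun _ _ h => PreRes.apps_equiv h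

def headApps {s : RSort} : Res s → ℕ :=
  Quotient.lift PreRes.headApps fun _ _ h => PreRes.headApps_equiv h

def depthSum {s : RSort} : Res s → ℕ :=
  Quotient.lift PreRes.depthSum fun _ _ h => PreRes.depthSum_equiv h

theorem view_var (n : ℕ) : view (var n) = (Sum.inl n : ℕ ⊕ Res .sim) := rfl

theorem view_lam (t : Res .sim) : view (lam t) = (Sum.inr t : ℕ ⊕ Res .sim) := by
  induction t using Quotient.ind; rfl

theorem view_app (s t : Res .sim) :
    view (app s t) = (Sum.inl (s, t) : (Res .sim × Res .sim) ⊕ Multiset (Res .val)) := by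
  induction s using Quotient.ind
  induction t using Quotient.ind
  rfl

theorem view_ofBag (b : Res .bag) :
    view (ofBag b) = (Sum.inr (view b) : (Res .sim × Res .sim) ⊕ Multiset (Res .val)) := by
  induction b using Quotient.ind; rfl

theorem view_cons (v : Res .val) (b : Res .bag) :
    view (cons v b) = (Multiset.cons v (view b) : Multiset (Res .val)) := by
  induction v using Quotient.ind
  induction b using Quotient.ind
  rfl

theorem view_foldr (m : Multiset (Res .val)) : view (m.foldr cons nil) = m := by
  induction m using Multiset.induction with
  | empty => rfl
  | cons v m ih => rw [Multiset.foldr_cons, view_cons, ih]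

theorem view_bag (m : Multiset (Res .val)) :
    view (bag m) = (Sum.inr m : (Res .sim × Res .sim) ⊕ Multiset (Res .val)) := by
  rw [bag, view_ofBag, view_foldr]

@[simp] theorem var_inj {m n : ℕ} : var m = var n ↔ m = n :=
  ⟨fun h => Sum.inl.inj (congrArg view h), congrArg var⟩

@[simp] theorem lam_inj {s t : Res .sim} : lam s = lam t ↔ s = t :=
  ⟨fun h => Sum.inr.inj ((view_lam _).symm.trans ((congrArg view h).trans (view_lam _))), congrArg lam⟩

@[simp] theorem app_inj {s t s' t' : Res .sim} : app s t = app s' t' ↔ s = s' ∧ t = t' :=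
  ⟨fun h => Prod.mk.inj (Sum.inl.inj ((view_app _ _).symm.trans ((congrArg view h).trans (view_app _ _)))),
    fun h => by rw [h.1, h.2]⟩

@[simp] theorem bag_inj {m m' : Multiset (Res .val)} : bag m = bag m' ↔ m = m' :=
  ⟨fun h => Sum.inr.inj ((view_bag _).symm.trans ((congrArg view h).trans (view_bag _))), congrArg bag⟩

@[simp] theorem var_ne_lam {n : ℕ} {t : Res .sim} : var n ≠ lam t := fun h => by
  have := congrArg view h
  rw [view_var, view_lam] at this
  exact Sum.inl_ne_inr this

@[simp] theorem lam_ne_var {n : ℕ} {t : Res .sim} : lam t ≠ var n := var_ne_lam.symm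

@[simp] theorem app_ne_bag {s t : Res .sim} {m : Multiset (Res .val)} : app s t ≠ bag m :=
  fun h => by
    have := congrArg view h
    rw [view_app, view_bag] at this
    exact Sum.inl_ne_inr this

@[simp] theorem bag_ne_app {s t : Res .sim} {m : Multiset (Res .val)} : bag m ≠ app s t :=
  app_ne_bag.symm

theorem induction {p : Res .val → Prop} {q : Res .sim → Prop} (var : ∀ n, p (var n))
    (lam : ∀ t, q t → p (lam t)) (app : ∀ s t, q s → q t → q (app s t))
    (bag : ∀ m : Multiset (Res .val), (∀ v ∈ m, p v) → q (bag m)) :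
    (∀ v, p v) ∧ ∀ t, q t := by
  -- The induction runs over representatives; on the bag sort the motive asserts a presentation by a
  -- multiset, so that `bag` applies.
  let motive : ∀ s, Res s → Prop
    | .val => p
    | .sim => q
    | .bag => fun b => ∃ m : Multiset (Res .val), b = m.foldr cons nil ∧ ∀ v ∈ m, p v
  have key : ∀ s (e : PreRes s), motive s (Quotient.mk _ e) := by
    intro s e
    induction e with
    | var n => exact var n
    | lam t ih => exact lam _ ih
    | app s t ih₁ ih₂ => exact app _ _ ih₁ ih₂
    | ofBag b ih =>
      obtain ⟨m, hm, h⟩ := ih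
      have := bag m h
      rwa [Res.bag, ← hm] at this
    | nil => exact ⟨0, rfl, by simp⟩
    | cons v b ih₁ ih₂ =>
      obtain ⟨m, hm, h⟩ := ih₂
      refine ⟨Quotient.mk _ v ::ₘ m, ?_, ?_⟩
      · exact (congrArg (cons (Quotient.mk _ v)) hm).trans (Multiset.foldr_cons _ _ _ _).symm
      · intro w hw
        rcases Multiset.mem_cons.1 hw with rfl | hw
        · exact ih₁
        · exact h w hw
  exact ⟨fun v => Quotient.ind (key .val) v, fun t => Quotient.ind (key .sim) t⟩

theorem shift_var (c n : ℕ) : shift c (var n) = var (if n < c then n else n + 1) := rfl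

theorem shift_lam (c : ℕ) (t : Res .sim) : shift c (lam t) = lam (shift (c + 1) t) := by
  induction t using Quotient.ind; rfl

theorem shift_app (c : ℕ) (s t : Res .sim) : shift c (app s t) = app (shift c s) (shift c t) := by
  induction s using Quotient.ind
  induction t using Quotient.ind
  rfl

theorem shift_ofBag (c : ℕ) (b : Res .bag) : shift c (ofBag b) = ofBag (shift c b) := by
  induction b using Quotient.ind; rfl

theorem shift_cons (c : ℕ) (v : Res .val) (b : Res .bag) :
    shift c (cons v b) = cons (shift c v) (shift c b) := by
  induction v using Quotient.ind
  induction b using Quotient.ind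
  rfl

theorem shift_bag (c : ℕ) (m : Multiset (Res .val)) : shift c (bag m) = bag (m.map (shift c)) := by
  rw [bag, bag, shift_ofBag]
  congr 1
  induction m using Multiset.induction with
  | empty => rfl
  | cons v m ih => rw [Multiset.foldr_cons, shift_cons, ih, Multiset.map_cons, Multiset.foldr_cons]

theorem bag_lift {f : {s : RSort} → Res s → ℕ} (h₀ : f nil = 0)
    (hc : ∀ v b, f (cons v b) = f v + f b) (hb : ∀ b, f (ofBag b) = f b)
    (m : Multiset (Res .val)) : f (bag m) = (m.map f).sum := by
  rw [bag, hb]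
  induction m using Multiset.induction with
  | empty => exact h₀
  | cons v m ih => rw [Multiset.foldr_cons, hc, ih, Multiset.map_cons, Multiset.sum_cons]

@[simp] theorem size_lam (t : Res .sim) : size (lam t) = size t + 1 := by
  induction t using Quotient.ind; rfl

@[simp] theorem size_app (s t : Res .sim) : size (app s t) = size s + size t + 1 := by
  induction s using Quotient.ind
  induction t using Quotient.ind
  rfl

@[simp] theorem size_bag (m : Multiset (Res .val)) : size (bag m) = (m.map size).sum :=
  bag_lift rfl (fun v b => Quotient.inductionOn₂ v b fun _ _ => rfl)
    (fun b => Quotient.inductionOn b fun _ => rfl) m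

@[simp] theorem size_shift {s : RSort} (c : ℕ) (e : Res s) : size (shift c e) = size e := by
  induction e using Quotient.ind with
  | _ e => exact PreRes.size_shift e c

@[simp] theorem apps_lam (t : Res .sim) : apps (lam t) = apps t := by
  induction t using Quotient.ind; rfl

@[simp] theorem apps_app (s t : Res .sim) : apps (app s t) = apps s + apps t + 1 := by
  induction s using Quotient.ind
  induction t using Quotient.ind
  rfl

@[simp] theorem apps_bag (m : Multiset (Res .val)) : apps (bag m) = (m.map apps).sum :=
  bag_lift rfl (fun v b => Quotient.inductionOn₂ v b fun _ _ => rfl)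
    (fun b => Quotient.inductionOn b fun _ => rfl) m

@[simp] theorem apps_shift {s : RSort} (c : ℕ) (e : Res s) : apps (shift c e) = apps e := by
  induction e using Quotient.ind with
  | _ e => exact PreRes.apps_shift e c

@[simp] theorem headApps_app (s t : Res .sim) : headApps (app s t) = apps s + apps t + 1 := by
  induction s using Quotient.ind
  induction t using Quotient.ind
  rfl

@[simp] theorem headApps_bag (m : Multiset (Res .val)) : headApps (bag m) = 0 := by
  rw [bag]
  induction m.foldr cons nil using Quotient.ind
  rfl

theorem headApps_le (t : Res .sim) : headApps t ≤ apps t :=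
  (induction (p := fun _ => True) (q := fun t => headApps t ≤ apps t) (fun _ => trivial)
    (fun _ _ => trivial) (fun _ _ _ _ => by simp) (fun _ _ => by simp)).2 t

@[simp] theorem headApps_lam (t : Res .sim) : headApps (lam t) = 0 := by
  induction t using Quotient.ind; rfl

@[simp] theorem depthSum_lam (t : Res .sim) : depthSum (lam t) = depthSum t := by
  induction t using Quotient.ind; rfl

@[simp] theorem depthSum_app (s t : Res .sim) :
    depthSum (app s t) = depthSum s + depthSum t + headApps s + apps t := by
  induction s using Quotient.ind
  induction t using Quotient.ind
  rfl

@[simp] theorem depthSum_bag (m : Multiset (Res .val)) :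
    depthSum (bag m) = (m.map depthSum).sum :=
  bag_lift rfl (fun v b => Quotient.inductionOn₂ v b fun _ _ => rfl)
    (fun b => Quotient.inductionOn b fun _ => rfl) m

@[simp] theorem depthSum_shift {s : RSort} (c : ℕ) (e : Res s) :
    depthSum (shift c e) = depthSum e := by
  induction e using Quotient.ind with
  | _ e => exact PreRes.depthSum_shift e c

/-! ### Finiteness and termination of the resource reduction -/

theorem LSubst.size_add {s : RSort} {k : ℕ} {vs : Multiset (Res .val)} {e e' : Res s}
    (h : LSubst k vs e e') : size e' + Multiset.card vs = size e + (vs.map size).sum := by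
  induction h with
  | var_eq k v => simp only [Multiset.card_singleton, Multiset.map_singleton,
      Multiset.sum_singleton]; exact add_comm _ _
  | var_lt h => simp
  | var_gt h => rfl
  | @lam _ vs _ _ _ ih =>
    have : ((vs.map (shift 0)).map size).sum = (vs.map size).sum := by simp
    rw [Multiset.card_map, this] at ih
    simp only [size_lam]
    omega
  | app _ _ ih₁ ih₂ => simp; omega
  | bag_nil k => simp
  | bag_cons _ _ ih₁ ih₂ => simp at ih₂ ⊢; omega

/-- `(β_r)` removes an abstraction, an application and one variable occurrence per substituted
resource; the `σ`-rules keep the size and lower the depths, as for `λ`-terms. The two middle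
equalities serve only to pass the decrease through applications. -/
theorem Step.measure {s : RSort} {e : Res s} {E : Set (Res s)} (h : Step e E) :
    ∀ e' ∈ E, size e' < size e ∨ size e' = size e ∧ apps e' = apps e ∧
      headApps e' = headApps e ∧ depthSum e' < depthSum e := by
  induction h with
  | beta t vs =>
    intro e' he'
    have := LSubst.size_add he'
    left
    simp; omega
  | zero => simp
  | sigma1 t s₁ s₂ =>
    rintro _ rfl
    right
    have := headApps_le t
    simp; omega
  | sigma3 v t s =>
    rintro _ rfl
    right
    simp; omega
  | lam _ ih =>
    rintro _ ⟨t, ht, rfl⟩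
    have := ih t ht
    simp; omega
  | appL _ _ ih =>
    rintro _ ⟨t, ht, rfl⟩
    have := ih t ht
    simp; omega
  | appR _ _ ih =>
    rintro _ ⟨t, ht, rfl⟩
    have := ih t ht
    simp; omega
  | bag _ _ ih =>
    rintro _ ⟨t, ht, rfl⟩
    have := ih t ht
    simp; omega

open Classical in
theorem lsubst_bag_finite (n : ℕ) : ∀ (m : Multiset (Res .val)), Multiset.card m = n →
    (∀ v ∈ m, ∀ k vs, {v' | LSubst k vs v v'}.Finite) →
      ∀ k vs, {t | LSubst k vs (bag m) t}.Finite := by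
  induction n with
  | zero =>
    intro m hm _ k vs
    obtain rfl := Multiset.card_eq_zero.1 hm
    refine (Set.finite_singleton (bag 0)).subset ?_
    intro t ht
    generalize hb : bag 0 = b at ht
    cases Set.mem_ofPred.1 ht with
    | app => simp at hb
    | bag_nil => rfl
    | bag_cons => simp at hb
  | succ n ih =>
    intro m hm h k vs
    -- The last rule used singles out some `v` of `m` and splits `vs` in two: finitely many choices.
    have key : {t | LSubst k vs (bag m) t} ⊆ ⋃ v ∈ m.toFinset, ⋃ p ∈ vs.antidiagonal.toFinset,
        Set.image2 (fun v' m' => bag (v' ::ₘ m')) {v' | LSubst k p.1 v v'}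
          (bag ⁻¹' {t | LSubst k p.2 (bag (m.erase v)) t}) := by
      intro t ht
      generalize hb : bag m = b at ht
      simp only [Set.mem_iUnion, Multiset.mem_toFinset]
      cases Set.mem_ofPred.1 ht with
      | app => simp at hb
      | bag_nil => simp only [bag_inj] at hb; simp [hb] at hm
      | @bag_cons _ vs ws v v' m₀ m' h₁ h₂ =>
        obtain rfl := bag_inj.1 hb
        refine ⟨v, by simp, (vs, ws), by simp, v', h₁, m', ?_, rfl⟩
        simpa using h₂
    refine Set.Finite.subset ?_ key
    refine Set.Finite.biUnion (Finset.finite_toSet _) fun v hv =>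
      Set.Finite.biUnion (Finset.finite_toSet _) fun p _ => Set.Finite.image2 _ ?_ ?_
    · exact h v (by simpa using hv) _ _
    · refine Set.Finite.preimage (fun _ _ _ _ => bag_inj.1) (ih _ ?_ ?_ _ _)
      · rw [Multiset.card_erase_of_mem (by simpa using hv), hm]; rfl
      · exact fun w hw => h w (Multiset.mem_of_mem_erase hw)

open Classical in
theorem lsubst_sim_finite (t : Res .sim) : ∀ k vs, {t' | LSubst k vs t t'}.Finite := by
  refine (induction (p := fun v => ∀ k vs, {v' | LSubst k vs v v'}.Finite)
    (q := fun t => ∀ k vs, {t' | LSubst k vs t t'}.Finite) ?_ ?_ ?_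
    (fun m h => lsubst_bag_finite _ m rfl h)).2 t
  · intro n k vs
    refine (((Set.finite_singleton (var (n - 1))).insert (var n)).union
      vs.toFinset.finite_toSet).subset ?_
    intro v hv
    generalize hb : var n = b at hv
    cases Set.mem_ofPred.1 hv with
    | var_eq => simp
    | var_lt => simp
    | var_gt => simp [var_inj.1 hb]
    | lam => simp at hb
  · intro t ht k vs
    refine ((ht (k + 1) (vs.map (shift 0))).image lam).subset ?_
    intro v hv
    generalize hb : lam t = b at hv
    cases Set.mem_ofPred.1 hv with
    | lam h => obtain rfl := lam_inj.1 hb; exact ⟨_, h, rfl⟩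
    | _ => simp at hb
  · intro s t hs ht k vs
    have key : {u | LSubst k vs (app s t) u} ⊆ ⋃ p ∈ vs.antidiagonal.toFinset,
        Set.image2 app {s' | LSubst k p.1 s s'} {t' | LSubst k p.2 t t'} := by
      intro u hu
      generalize hb : app s t = b at hu
      cases Set.mem_ofPred.1 hu with
      | @app _ vs ws _ _ _ _ h₁ h₂ =>
        obtain ⟨rfl, rfl⟩ := app_inj.1 hb
        simp only [Set.mem_iUnion]
        exact ⟨(vs, ws), by simp, _, h₁, _, h₂, rfl⟩
      | _ => simp at hb
    exact (Set.Finite.biUnion (Finset.finite_toSet _) fun p _ =>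
      Set.Finite.image2 _ (hs _ _) (ht _ _)).subset key

theorem Step.finite {s : RSort} {e : Res s} {E : Set (Res s)} (h : Step e E) : E.Finite := by
  induction h with
  | beta t vs => exact lsubst_sim_finite t 0 vs
  | zero => exact Set.finite_empty
  | sigma1 => exact Set.finite_singleton _
  | sigma3 => exact Set.finite_singleton _
  | _ => exact Set.Finite.image _ ‹_›

-- Normal forms of sets of resource terms

/-- The terms which do not reduce. -/
def Normal {s : RSort} (e : Res s) : Prop := ∀ E, ¬ Step e E

/-- One of the elements of a one-step reduct of a resource expression. -/
def EStep {s : RSort} (e e' : Res s) : Prop := ∃ E, Step e E ∧ e' ∈ E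

abbrev ESteps {s : RSort} : Res s → Res s → Prop := Relation.ReflTransGen EStep

theorem wellFounded_estep {s : RSort} : WellFounded fun e' e : Res s => EStep e e' := by
  refine Subrelation.wf (r := InvImage (Prod.Lex (· < ·) (· < ·)) fun e => (size e, depthSum e))
    ?_ (InvImage.wf _ (WellFounded.prod_lex Nat.lt_wfRel.wf Nat.lt_wfRel.wf))
  rintro e' e ⟨E, h, he'⟩
  rcases h.measure e' he' with h | ⟨h, -, -, h'⟩
  · exact .left _ _ h
  · simp only [InvImage, h]; exact .right _ h'

theorem SetStep.of_mem {s : RSort} {e : Res s} {E E₁ : Set (Res s)} (he : e ∈ E)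
    (h : Step e E₁) : SetStep E (E₁ ∪ E \ {e}) := by
  have := SetStep.mk (E₂ := E \ {e}) h (by simp)
  rwa [Set.union_sdiff_cancel (by simpa using he)] at this

theorem not_setStep_iff {s : RSort} {F : Set (Res s)} :
    (¬ ∃ F', SetStep F F') ↔ ∀ e ∈ F, Normal e := by
  constructor
  · intro h e he E hE
    exact h ⟨_, .of_mem he hE⟩
  · rintro h ⟨F', hF⟩
    cases hF with
    | mk hs _ => exact h _ (by simp) _ hs

open Classical in
-- A set step replaces one element by finitely many smaller ones, which is well founded by the hydra
-- order `Relation.CutExpand` on multisets. Normal elements are never selected, so they persist.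
theorem exists_normalForm_finset {s : RSort} (E : Finset (Res s)) :
    ∃ F : Set (Res s), IsNormalFormOf F E ∧ ∀ a ∈ E, Normal a → a ∈ F := by
  have : Std.Irrefl fun e' e : Res s => EStep e e' :=
    ⟨fun e => wellFounded_estep.irrefl.irrefl e⟩
  have wf := InvImage.wf (fun E : Finset (Res s) => E.val) (wellFounded_estep (s := s)).cutExpand
  induction E using wf.induction with
  | _ E ih =>
    by_cases h : ∀ e ∈ E, Normal e
    · exact ⟨E, ⟨.refl, not_setStep_iff.2 h⟩, fun a ha _ => ha⟩
    · simp only [Normal, not_forall, not_not] at h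
      obtain ⟨e, he, E₁, hE₁⟩ := h
      have hfin := hE₁.finite
      -- Elements of `E₁` already present are left out, so that the union of sets is also a sum of
      -- multisets.
      let E' := (E.erase e).disjUnion (hfin.toFinset \ E.erase e) Finset.disjoint_sdiff
      have hE' : (E' : Set (Res s)) = E₁ ∪ (E : Set (Res s)) \ {e} := by
        ext a
        simp only [E', Finset.coe_disjUnion, Finset.coe_erase, Finset.coe_sdiff,
          Set.Finite.coe_toFinset, Set.mem_union, Set.mem_sdiff]
        tauto
      obtain ⟨F, ⟨hF, hn⟩, hF'⟩ := ih E' ⟨(hfin.toFinset \ E.erase e).val, e, fun a ha => by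
          simp only [Finset.mem_val, Finset.mem_sdiff, Set.Finite.mem_toFinset] at ha
          exact ⟨E₁, hE₁, ha.1⟩, by
          change (E.erase e).val + _ + {e} = _
          rw [add_right_comm, Finset.erase_val, add_comm (E.val.erase e) {e},
            Multiset.singleton_add, Multiset.cons_erase he]⟩
      refine ⟨F, ⟨.head ?_ hF, hn⟩, fun a ha hna => hF' a ?_ hna⟩
      · rw [hE']
        exact .of_mem he hE₁
      · rw [← Finset.mem_coe, hE']
        exact .inr ⟨ha, by rintro rfl; exact hna _ hE₁⟩

theorem mem_NF_iff {s : RSort} {E : Set (Res s)} {a : Res s} :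
    a ∈ NF E ↔ ∃ e ∈ E, ESteps e a ∧ Normal a := by
  constructor
  · rintro ⟨e, he, F, ⟨hF, hn⟩, ha⟩
    refine ⟨e, he, ?_, not_setStep_iff.1 hn a ha⟩
    clear hn
    induction hF generalizing a with
    | refl => obtain rfl := Set.mem_singleton_iff.1 ha; exact .refl
    | tail _ h ih =>
      cases h with
      | mk h _ =>
        rcases ha with ha | ha
        · exact (ih (.inl rfl)).tail ⟨_, h, ha⟩
        · exact ih (.inr ha)
  · rintro ⟨e, he, h, hn⟩
    -- Set steps follow the path from `e` to `a`, reducing at each stage the current element of the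
    -- path.
    have key : ∃ E : Set (Res s), E.Finite ∧ a ∈ E ∧ Relation.ReflTransGen SetStep {e} E := by
      clear hn
      induction h with
      | refl => exact ⟨{e}, Set.finite_singleton e, rfl, .refl⟩
      | tail _ h ih =>
        obtain ⟨E, hE, hb, hs⟩ := ih
        obtain ⟨E₁, h₁, hc⟩ := h
        exact ⟨_, h₁.finite.union hE.sdiff, .inl hc, hs.tail (.of_mem hb h₁)⟩
    obtain ⟨E, hE, ha, hs⟩ := key
    obtain ⟨F, ⟨hF, hnF⟩, h'⟩ := exists_normalForm_finset hE.toFinset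
    rw [hE.coe_toFinset] at hF
    exact ⟨e, he, F, ⟨hs.trans hF, hnF⟩, h' a (by simpa using ha) hn⟩

end Res
open Res

/-! ### Resource expressions approximating a reduct of a term -/

/-- `Approx e M`: the resource expression `e` approximates `M`, where every subterm of `M` may be
reduced independently for each of the resources which approximate it. -/
inductive Approx : {s : RSort} → Res s → Lam → Prop
  | var (n : ℕ) : Approx (Res.var n) (.var n)
  | lam {t : Res .sim} {M : Lam} : Approx t M → Approx (Res.lam t) (.lam M)
  | app {s t : Res .sim} {M P Q : Lam} : Lam.Steps M (.app P Q) → Approx s P → Approx t Q →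
      Approx (Res.app s t) M
  | bag {m : Multiset (Res .val)} {M V : Lam} : Lam.Steps M V → V.IsValue →
      (∀ v ∈ m, Approx v V) → Approx (Res.bag m) M

theorem approx_lam_iff {t : Res .sim} {M : Lam} :
    Approx (lam t) M ↔ ∃ N, M = .lam N ∧ Approx t N := by
  constructor
  · intro h
    generalize he : lam t = e at h
    cases h with
    | var => simp at he
    | lam h => obtain rfl := lam_inj.1 he; exact ⟨_, rfl, h⟩
  · rintro ⟨N, rfl, h⟩; exact .lam h

theorem approx_var_iff {n : ℕ} {M : Lam} : Approx (var n) M ↔ M = .var n := by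
  constructor
  · intro h
    generalize he : var n = e at h
    cases h with
    | var => rw [var_inj.1 he]
    | lam h => simp at he
  · rintro rfl; exact .var n

theorem approx_app_iff {s t : Res .sim} {M : Lam} :
    Approx (app s t) M ↔ ∃ P Q, Lam.Steps M (.app P Q) ∧ Approx s P ∧ Approx t Q := by
  constructor
  · intro h
    generalize he : app s t = e at h
    cases h with
    | app h h₁ h₂ => obtain ⟨rfl, rfl⟩ := app_inj.1 he; exact ⟨_, _, h, h₁, h₂⟩
    | bag => simp at he
  · rintro ⟨P, Q, h, h₁, h₂⟩; exact .app h h₁ h₂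

theorem approx_bag_iff {m : Multiset (Res .val)} {M : Lam} :
    Approx (bag m) M ↔ ∃ V, Lam.Steps M V ∧ V.IsValue ∧ ∀ v ∈ m, Approx v V := by
  constructor
  · intro h
    generalize he : bag m = e at h
    cases h with
    | app h h₁ h₂ => simp at he
    | bag h h₁ h₂ => obtain rfl := bag_inj.1 he; exact ⟨_, h, h₁, h₂⟩
  · rintro ⟨V, h, h₁, h₂⟩; exact .bag h h₁ h₂

theorem Approx.of_steps {t : Res .sim} {M N : Lam} (h : Approx t N) (hM : Lam.Steps M N) :
    Approx t M := by
  cases h with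
  | app h h₁ h₂ => exact .app (hM.trans h) h₁ h₂
  | bag h h₁ h₂ => exact .bag (hM.trans h) h₁ h₂

theorem Approx.shift {s : RSort} {e : Res s} {M : Lam} (h : Approx e M) :
    ∀ c, Approx (e.shift c) (M.shift c) := by
  induction h with
  | var n => exact fun c => .var _
  | lam _ ih => intro c; rw [shift_lam]; exact .lam (ih _)
  | app h _ _ ih₁ ih₂ => intro c; rw [shift_app]; exact .app (h.shift c) (ih₁ c) (ih₂ c)
  | bag h hV _ ih =>
    intro c
    rw [shift_bag]
    refine .bag (h.shift c) (hV.shift c) fun v hv => ?_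
    obtain ⟨w, hw, rfl⟩ := Multiset.mem_map.1 hv
    exact ih w hw c

/-- A bag whose elements all approximate the given value. -/
inductive BagApprox : {s : RSort} → Res s → Lam → Prop
  | mk {m : Multiset (Res .val)} {V : Lam} : (∀ v ∈ m, Approx v V) → BagApprox (Res.bag m) V

theorem bagApprox_iff {m : Multiset (Res .val)} {V : Lam} :
    BagApprox (bag m) V ↔ ∀ v ∈ m, Approx v V := by
  constructor
  · intro h
    generalize he : bag m = e at h
    cases h with
    | mk h => obtain rfl := bag_inj.1 he; exact h
  · exact .mk

theorem not_bagApprox_app {s t : Res .sim} {V : Lam} : ¬ BagApprox (app s t) V := by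
  intro h
  generalize he : app s t = e at h
  cases h with
  | mk h => simp at he

/-- The statement on `BagApprox` strengthens the induction: `Approx` of a bag only provides some
value reduct, which could differ between the head and the tail of the bag. -/
theorem Res.LSubst.approx {s : RSort} {k : ℕ} {vs : Multiset (Res .val)} {e e' : Res s}
    (h : LSubst k vs e e') : ∀ {V : Lam}, V.IsValue → (∀ v ∈ vs, Approx v V) → ∀ M,
      (Approx e M → Approx e' (Lam.subst k V M)) ∧
      (BagApprox e M → BagApprox e' (Lam.subst k V M)) := by
  induction h with
  | var_eq k v =>
    refine fun hV hvs M => ⟨fun h => ?_, nofun⟩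
    obtain rfl := approx_var_iff.1 h
    simpa [Lam.subst] using hvs v (by simp)
  | var_lt hlt =>
    refine fun hV hvs M => ⟨fun h => ?_, nofun⟩
    obtain rfl := approx_var_iff.1 h
    simpa [Lam.subst, hlt.ne, hlt] using Approx.var _
  | var_gt hlt =>
    refine fun hV hvs M => ⟨fun h => ?_, nofun⟩
    obtain rfl := approx_var_iff.1 h
    simpa [Lam.subst, hlt.ne', hlt.not_gt] using Approx.var _
  | lam _ ih =>
    refine fun hV hvs M => ⟨fun h => ?_, nofun⟩
    obtain ⟨N, rfl, h'⟩ := approx_lam_iff.1 h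
    refine .lam ((ih (hV.shift 0) (fun v hv => ?_) N).1 h')
    obtain ⟨w, hw, rfl⟩ := Multiset.mem_map.1 hv
    exact (hvs w hw).shift 0
  | app _ _ ih₁ ih₂ =>
    refine fun hV hvs M => ⟨fun h => ?_, fun h => absurd h not_bagApprox_app⟩
    obtain ⟨P, Q, h, h₁, h₂⟩ := approx_app_iff.1 h
    exact .app (h.subst _ hV)
      ((ih₁ hV (fun v hv => hvs v (Multiset.mem_add.2 (.inl hv))) P).1 h₁)
      ((ih₂ hV (fun v hv => hvs v (Multiset.mem_add.2 (.inr hv))) Q).1 h₂)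
  | bag_nil k =>
    refine fun hV hvs M => ⟨fun h => ?_, fun _ => .mk (by simp)⟩
    obtain ⟨W, h, hW, -⟩ := approx_bag_iff.1 h
    exact .bag (h.subst _ hV) (hW.subst hV _) (by simp)
  | @bag_cons k vs ws v v' m m' _ _ ih₁ ih₂ =>
    intro V hV hvs M
    have key : ∀ W, BagApprox (bag (v ::ₘ m)) W →
        BagApprox (bag (v' ::ₘ m')) (Lam.subst k V W) := by
      intro W h
      rw [bagApprox_iff, Multiset.forall_mem_cons] at h ⊢
      exact ⟨(ih₁ hV (fun v hv => hvs v (Multiset.mem_add.2 (.inl hv))) W).1 h.1,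
        bagApprox_iff.1 ((ih₂ hV (fun v hv => hvs v (Multiset.mem_add.2 (.inr hv))) W).2
          (bagApprox_iff.2 h.2))⟩
    refine ⟨fun h => ?_, key M⟩
    obtain ⟨W, h, hW, h'⟩ := approx_bag_iff.1 h
    exact .bag (h.subst _ hV) (hW.subst hV _) (bagApprox_iff.1 (key W (bagApprox_iff.2 h')))

/-- A resource redex only becomes a redex of a reduct of `M`: the reductions recorded in `Approx`
are performed first, then the corresponding `v`-rule. -/
theorem Res.Step.approx {s : RSort} {e : Res s} {E : Set (Res s)} (h : Step e E) :
    ∀ {M : Lam}, Approx e M → ∀ e' ∈ E, Approx e' M := by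
  induction h with
  | beta t vs =>
    intro M h e' he'
    obtain ⟨P, Q, h, h₁, h₂⟩ := approx_app_iff.1 h
    obtain ⟨V, hP, -, h₁⟩ := approx_bag_iff.1 h₁
    obtain ⟨N, rfl, hu⟩ := approx_lam_iff.1 (h₁ _ (Multiset.mem_singleton_self _))
    obtain ⟨V, hQ, hV, h₂⟩ := approx_bag_iff.1 h₂
    exact ((LSubst.approx he' hV h₂ N).1 hu).of_steps
      ((h.trans (hP.app hQ)).trans (.single (.beta N V hV)))
  | zero => simp
  | sigma1 t s₁ s₂ =>
    rintro M h _ rfl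
    obtain ⟨P, Q, h, h₁, h₂⟩ := approx_app_iff.1 h
    obtain ⟨P₁, P₂, hP, h₁, h₃⟩ := approx_app_iff.1 h₁
    obtain ⟨V, hP₁, -, h₁⟩ := approx_bag_iff.1 h₁
    obtain ⟨N, rfl, hu⟩ := approx_lam_iff.1 (h₁ _ (Multiset.mem_singleton_self _))
    refine .app (P := .lam (.app N (Q.shift 0))) (Q := P₂) ?_
      (.bag .refl (.lam _) (by simpa using .lam (.app .refl hu (h₂.shift 0)))) h₃
    exact (h.trans ((hP.trans (hP₁.app .refl)).app .refl)).trans (.single (.sigma1 _ _ _))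
  | sigma3 v t s =>
    rintro M h _ rfl
    obtain ⟨P, Q, h, h₁, h₂⟩ := approx_app_iff.1 h
    obtain ⟨Q₁, Q₂, hQ, h₂, h₃⟩ := approx_app_iff.1 h₂
    obtain ⟨V, hP, hV, h₁⟩ := approx_bag_iff.1 h₁
    obtain ⟨W, hQ₁, -, h₂⟩ := approx_bag_iff.1 h₂
    obtain ⟨N, rfl, hu⟩ := approx_lam_iff.1 (h₂ _ (Multiset.mem_singleton_self _))
    refine .app (P := .lam (.app (V.shift 0) N)) (Q := Q₂) ?_
      (.bag .refl (.lam _) (by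
        simpa using .lam (.app .refl (.bag .refl (hV.shift 0)
          (by simpa using (h₁ v (by simp)).shift 0)) hu))) h₃
    exact (h.trans (hP.app (hQ.trans (hQ₁.app .refl)))).trans (.single (.sigma3 _ _ _ hV))
  | lam _ ih =>
    rintro M h _ ⟨t, ht, rfl⟩
    obtain ⟨N, rfl, h'⟩ := approx_lam_iff.1 h
    exact .lam (ih h' t ht)
  | appL _ _ ih =>
    rintro M h _ ⟨t, ht, rfl⟩
    obtain ⟨P, Q, h, h₁, h₂⟩ := approx_app_iff.1 h
    exact .app h (ih h₁ t ht) h₂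
  | appR _ _ ih =>
    rintro M h _ ⟨t, ht, rfl⟩
    obtain ⟨P, Q, h, h₁, h₂⟩ := approx_app_iff.1 h
    exact .app h h₁ (ih h₂ t ht)
  | bag _ _ ih =>
    rintro M h _ ⟨t, ht, rfl⟩
    obtain ⟨V, h, hV, h'⟩ := approx_bag_iff.1 h
    rw [Multiset.forall_mem_cons] at h'
    exact .bag h hV (Multiset.forall_mem_cons.2 ⟨ih h'.1 t ht, h'.2⟩)

theorem Res.ESteps.approx {s : RSort} {e e' : Res s} {M : Lam} (h : ESteps e e') (hM : Approx e M) :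
    Approx e' M := by
  induction h with
  | refl => exact hM
  | tail _ h ih => obtain ⟨E, h, he⟩ := h; exact h.approx ih _ he

/-! ### Taylor expansion -/

theorem bag_mem_taylor_var {x : ℕ} {m : Multiset (Res .val)} :
    bag m ∈ taylor (.var x) ↔ ∀ v ∈ m, v = var x := by
  change (∃ n : ℕ, bag m = bag _) ↔ _
  simp only [bag_inj]
  exact ⟨fun ⟨n, h⟩ v hv => Multiset.eq_of_mem_replicate (h ▸ hv),
    fun h => ⟨_, Multiset.eq_replicate_card.2 h⟩⟩

theorem exists_eq_map {α β : Type*} {p : α → Prop} {f : α → β} {m : Multiset β}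
    (h : ∀ b ∈ m, ∃ a, p a ∧ b = f a) : ∃ m' : Multiset α, (∀ a ∈ m', p a) ∧ m = m'.map f := by
  induction m using Multiset.induction with
  | empty => exact ⟨0, by simp⟩
  | cons b m ih =>
    rw [Multiset.forall_mem_cons] at h
    obtain ⟨⟨a, ha, rfl⟩, h⟩ := h
    obtain ⟨m', hm', rfl⟩ := ih h
    exact ⟨a ::ₘ m', Multiset.forall_mem_cons.2 ⟨ha, hm'⟩, by simp⟩

theorem exists_bag_map_lam_iff {S : Set (Res .sim)} {m : Multiset (Res .val)} :
    (∃ m' : Multiset (Res .sim), (∀ u ∈ m', u ∈ S) ∧ bag m = bag (m'.map lam)) ↔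
      ∀ v ∈ m, ∃ t ∈ S, v = lam t := by
  simp only [bag_inj]
  constructor
  · rintro ⟨m', h, rfl⟩ v hv
    obtain ⟨t, ht, rfl⟩ := Multiset.mem_map.1 hv
    exact ⟨t, h t ht, rfl⟩
  · exact exists_eq_map

theorem bag_mem_taylor_lam {N : Lam} {m : Multiset (Res .val)} :
    bag m ∈ taylor (.lam N) ↔ ∀ v ∈ m, ∃ t ∈ taylor N, v = lam t :=
  exists_bag_map_lam_iff

theorem exists_bag_of_mem_taylor {V : Lam} (hV : V.IsValue) {e : Res .sim} (h : e ∈ taylor V) :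
    ∃ m, e = bag m := by
  cases hV with
  | var n => obtain ⟨n, rfl⟩ := h; exact ⟨_, rfl⟩
  | lam N => obtain ⟨m, -, rfl⟩ := h; exact ⟨_, rfl⟩

theorem bag_mem_taylor {V : Lam} (hV : V.IsValue) {m : Multiset (Res .val)} :
    bag m ∈ taylor V ↔ ∀ v ∈ m, bag {v} ∈ taylor V := by
  cases hV <;> simp [bag_mem_taylor_var, bag_mem_taylor_lam]

theorem isValue_of_bag_mem_taylor {M : Lam} {m : Multiset (Res .val)} (h : bag m ∈ taylor M) :
    M.IsValue := by
  cases M with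
  | app => obtain ⟨s, -, t, -, h⟩ := h; simp at h
  | _ => constructor

theorem approx_of_mem_taylor {M : Lam} : ∀ {e : Res .sim}, e ∈ taylor M → Approx e M := by
  induction M with
  | var n =>
    rintro _ ⟨k, rfl⟩
    exact .bag .refl (.var n) fun v hv => by
      rw [Multiset.eq_of_mem_replicate hv]; exact .var n
  | lam M ih =>
    rintro _ ⟨m, hm, rfl⟩
    refine .bag .refl (.lam M) fun v hv => ?_
    obtain ⟨t, ht, rfl⟩ := Multiset.mem_map.1 hv
    exact .lam (ih (hm t ht))
  | app P Q ih₁ ih₂ =>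
    rintro _ ⟨s, hs, t, ht, rfl⟩
    exact .app .refl (ih₁ hs) (ih₂ ht)

/-! ### Normal resource terms -/

namespace Res

theorem Normal.of_lam {t : Res .sim} (h : Normal (lam t)) : Normal t := fun _ hE => h _ (.lam hE)

theorem Normal.of_app_left {s t : Res .sim} (h : Normal (app s t)) : Normal s :=
  fun _ hE => h _ (.appL _ hE)

theorem Normal.of_app_right {s t : Res .sim} (h : Normal (app s t)) : Normal t :=
  fun _ hE => h _ (.appR _ hE)

theorem Normal.of_mem_bag {m : Multiset (Res .val)} (h : Normal (bag m)) {v : Res .val}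
    (hv : v ∈ m) : Normal v := by
  obtain ⟨m, rfl⟩ := Multiset.exists_cons_of_mem hv
  exact fun _ hE => h _ (.bag _ hE)

theorem Normal.eq_singleton {m : Multiset (Res .val)} {t : Res .sim} (h : Normal (app (bag m) t)) :
    ∃ v, m = {v} :=
  Multiset.card_eq_one.1 (by by_contra h'; exact h _ (.zero m t h'))

/-- A simple term of the form `[λx.t]s`. -/
def IsLet (e : Res .sim) : Prop := ∃ t s, e = app (bag {lam t}) s

theorem Normal.not_isLet_left {s t : Res .sim} (h : Normal (app s t)) : ¬ IsLet s := by
  rintro ⟨u, r, rfl⟩; exact h _ (.sigma1 _ _ _)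

theorem Normal.not_isLet_right {m : Multiset (Res .val)} {t : Res .sim}
    (h : Normal (app (bag m) t)) : ¬ IsLet t := by
  rintro ⟨u, r, rfl⟩
  obtain ⟨v, rfl⟩ := h.eq_singleton
  exact h _ (.sigma3 _ _ _)

theorem Normal.not_bag_right {t u : Res .sim} (h : Normal (app (bag {lam u}) t))
    (m : Multiset (Res .val)) : t ≠ bag m := by
  rintro rfl; exact h _ (.beta _ _)

theorem normal_bag {m : Multiset (Res .val)} (h : ∀ v ∈ m, Normal v) : Normal (bag m) := by
  intro E hE
  generalize he : bag m = e at hE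
  cases hE with
  | bag _ hs => obtain rfl := bag_inj.1 he; exact h _ (by simp) _ hs
  | _ => simp at he

theorem normal_var (n : ℕ) : Normal (var n) := by
  intro E hE
  generalize he : var n = e at hE
  cases hE with
  | lam => simp at he

theorem normal_lam {t : Res .sim} (h : Normal t) : Normal (lam t) := by
  intro E hE
  generalize he : lam t = e at hE
  cases hE with
  | lam hs => obtain rfl := lam_inj.1 he; exact h _ hs

theorem normal_app {s t : Res .sim} (hs : Normal s) (ht : Normal t)
    (hs' : ¬ IsLet s) (h : ∀ m, s = bag m → ∃ v, m = {v} ∧ ¬ IsLet t ∧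
      ((∃ n, v = var n) ∨ ∀ m', t ≠ bag m')) : Normal (app s t) := by
  intro E hE
  generalize he : app s t = e at hE
  cases hE with
  | beta u vs =>
    obtain ⟨rfl, rfl⟩ := app_inj.1 he
    obtain ⟨v, hv, -, h⟩ := h _ rfl
    obtain rfl := Multiset.singleton_inj.1 hv
    rcases h with ⟨n, h⟩ | h
    · simp at h
    · exact h _ rfl
  | zero vs t hc =>
    obtain ⟨rfl, rfl⟩ := app_inj.1 he
    obtain ⟨v, rfl, -⟩ := h _ rfl
    simp at hc
  | sigma1 =>
    obtain ⟨rfl, rfl⟩ := app_inj.1 he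
    exact hs' ⟨_, _, rfl⟩
  | sigma3 =>
    obtain ⟨rfl, rfl⟩ := app_inj.1 he
    obtain ⟨v, -, h, -⟩ := h _ rfl
    exact h ⟨_, _, rfl⟩
  | appL _ h' => obtain ⟨rfl, rfl⟩ := app_inj.1 he; exact hs _ h'
  | appR _ h' => obtain ⟨rfl, rfl⟩ := app_inj.1 he; exact ht _ h'
  | bag => simp at he

end Res

-- Normal elements of Taylor expansions along reductions

theorem isLet_of_mem_taylor {M N : Lam} {e t : Res .sim}
    (h : e ∈ taylor (.app (.lam M) N)) (hn : Normal e ∨ Normal (app e t)) : IsLet e := by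
  obtain ⟨s, hs, u, -, rfl⟩ := h
  obtain ⟨m, hm, rfl⟩ := hs
  obtain ⟨v, hv⟩ := Normal.eq_singleton (hn.elim id Normal.of_app_left)
  obtain ⟨t, rfl, rfl⟩ := Multiset.map_eq_singleton.1 hv
  exact ⟨t, u, by rw [Multiset.map_singleton]⟩

/-- Rule `(0)` forces one resource in the bag of a head abstraction, so a root redex of `M` would be
a root redex of `e`. Elsewhere the step acts on normal subterms, vacuously under an empty bag. -/
theorem Lam.Step.mem_taylor_of_normal {M N : Lam} (h : Lam.Step M N) :
    ∀ {e : Res .sim}, Normal e → e ∈ taylor M → e ∈ taylor N := by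
  induction h with
  | beta M V hV =>
    intro e hn he
    obtain ⟨t, s, rfl⟩ := isLet_of_mem_taylor (t := bag 0) he (.inl hn)
    obtain ⟨_, _, u, hu, h⟩ := he
    obtain ⟨-, rfl⟩ := app_inj.1 h
    obtain ⟨m, rfl⟩ := exists_bag_of_mem_taylor hV hu
    exact absurd rfl (hn.not_bag_right m)
  | sigma1 M N P =>
    rintro e hn ⟨s, hs, u, -, rfl⟩
    exact absurd (isLet_of_mem_taylor hs (.inr hn)) hn.not_isLet_left
  | sigma3 V M N hV =>
    rintro e hn ⟨s, hs, u, hu, rfl⟩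
    obtain ⟨m, rfl⟩ := exists_bag_of_mem_taylor hV hs
    exact absurd (isLet_of_mem_taylor (t := bag 0) hu (.inl hn.of_app_right)) hn.not_isLet_right
  | lam _ ih =>
    rintro e hn ⟨m, hm, rfl⟩
    exact ⟨m, fun u hu => ih (hn.of_mem_bag (Multiset.mem_map_of_mem _ hu)).of_lam (hm u hu), rfl⟩
  | appL _ _ ih =>
    rintro e hn ⟨s, hs, u, hu, rfl⟩
    exact ⟨s, ih hn.of_app_left hs, u, hu, rfl⟩
  | appR _ _ ih =>
    rintro e hn ⟨s, hs, u, hu, rfl⟩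
    exact ⟨s, hs, u, ih hn.of_app_right hu, rfl⟩

theorem Lam.Steps.mem_taylor_of_normal {M N : Lam} (h : Lam.Steps M N) {e : Res .sim}
    (hn : Normal e) (he : e ∈ taylor M) : e ∈ taylor N := by
  induction h with
  | refl => exact he
  | tail _ h ih => exact h.mem_taylor_of_normal hn ih

/-- A resource value as the simple term given by the bag it generates; simple terms themselves. -/
def toSim : {s : RSort} → Res s → Res .sim
  | .val, v => bag {v}
  | .sim, t => t
  | .bag, b => ofBag b

theorem Approx.exists_mem_taylor {s : RSort} {e : Res s} {M : Lam} (h : Approx e M) :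
    Normal e → ∃ N, Lam.Steps M N ∧ toSim e ∈ taylor N := by
  induction h with
  | var n =>
    exact fun _ => ⟨_, .refl, bag_mem_taylor_var.2 (by simp)⟩
  | lam _ ih =>
    intro hn
    obtain ⟨N, h, ht⟩ := ih hn.of_lam
    exact ⟨_, h.lam, bag_mem_taylor_lam.2 (by simpa [toSim] using ht)⟩
  | app h _ _ ih₁ ih₂ =>
    intro hn
    obtain ⟨P, h₁, hs⟩ := ih₁ hn.of_app_left
    obtain ⟨Q, h₂, ht⟩ := ih₂ hn.of_app_right
    exact ⟨_, h.trans (h₁.app h₂), _, hs, _, ht, rfl⟩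
  | @bag m M V h hV _ ih =>
    intro hn
    suffices ∃ N, Lam.Steps V N ∧ Res.bag m ∈ taylor N by
      obtain ⟨N, h', hN⟩ := this
      exact ⟨N, h.trans h', hN⟩
    clear h
    induction m using Multiset.induction with
    | empty => exact ⟨V, .refl, (bag_mem_taylor hV).2 (by simp)⟩
    | cons v m ihm =>
      obtain ⟨N₁, h₁, hv⟩ := ih v (by simp) (hn.of_mem_bag (by simp))
      obtain ⟨N₂, h₂, hm⟩ := ihm (fun v hv => ‹∀ v ∈ _, Approx v V› v (by simp [hv]))
        (fun v hv => ih v (by simp [hv]))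
        (normal_bag fun v hv => hn.of_mem_bag (by simp [hv]))
      -- The head and the tail of the bag chose different reducts of `V`; both survive, being
      -- normal, in a common reduct.
      obtain ⟨N, h₁', h₂'⟩ := h₁.confluent h₂
      have hN := (h₁.trans h₁').isValue hV
      refine ⟨N, h₁.trans h₁', (bag_mem_taylor hN).2 (Multiset.forall_mem_cons.2 ⟨?_, ?_⟩)⟩
      · exact Lam.Steps.mem_taylor_of_normal h₁'
          (normal_bag (by simpa using hn.of_mem_bag (Multiset.mem_cons_self v m))) hv
      · exact (bag_mem_taylor hN).1 (Lam.Steps.mem_taylor_of_normal h₂'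
          (normal_bag fun v hv => hn.of_mem_bag (by simp [hv])) hm)

/-! ### The greatest approximant of a term -/

open Classical in
/-- The greatest approximant below a term, if there is one: the bodies of abstractions which have
no approximant are cut. -/
noncomputable def Lam.cut : Lam → LamBot
  | .var n => .var n
  | .lam M => if LamBot.IsA M.cut then .lam M.cut else .bot
  | .app P Q => .app P.cut Q.cut

theorem Lam.cut_le (M : Lam) : LamBot.Le M.cut M.toBot := by
  induction M with
  | var n => exact .refl _
  | lam M ih =>
    rw [cut]
    split_ifs
    · exact .lam ih
    · exact .bot_lam _
  | app P Q ih₁ ih₂ => exact .trans (.appL _ ih₁) (.appR _ ih₂)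

theorem Lam.eq_app_of_cut_eq_app {M : Lam} {A B : LamBot} (h : M.cut = .app A B) :
    ∃ P Q, M = .app P Q ∧ P.cut = A ∧ Q.cut = B := by
  cases M with
  | var => cases h
  | lam => rw [cut] at h; split_ifs at h
  | app P Q => cases h; exact ⟨P, Q, rfl, rfl, rfl⟩

theorem Lam.eq_lam_of_cut_eq_lam {M : Lam} {A : LamBot} (h : M.cut = .lam A) :
    ∃ N, M = .lam N := by
  cases M with
  | lam N => exact ⟨N, rfl⟩
  | _ => cases h

theorem isB_cut_of_not_isLet {M : Lam} {e t : Res .sim} (h : LamBot.IsA M.cut) (he : e ∈ taylor M)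
    (hn : Normal e ∨ Normal (app e t)) (hl : ¬ IsLet e) : LamBot.IsB M.cut := by
  generalize hc : M.cut = C at h
  cases h with
  | ofB h => exact h
  | redex _ _ =>
    obtain ⟨P, Q, rfl, hP, -⟩ := Lam.eq_app_of_cut_eq_app hc
    obtain ⟨N, rfl⟩ := Lam.eq_lam_of_cut_eq_lam hP
    exact absurd (isLet_of_mem_taylor he hn) hl

theorem isSpine_cut_of_isB {M : Lam} {e : Res .sim} (h : LamBot.IsB M.cut) (he : e ∈ taylor M)
    (hb : ∀ m, e ≠ bag m) : LamBot.IsSpine M.cut := by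
  have hM : ∀ {P Q}, M.cut = .app P Q → LamBot.IsSpine M.cut := by
    intro P Q hc
    cases hB : M.cut <;> rw [hB] at h hc <;> cases hc
    cases h with
    | spine h => exact h
  cases M with
  | app P Q => exact hM rfl
  | var => obtain ⟨m, rfl⟩ := exists_bag_of_mem_taylor (.var _) he; exact absurd rfl (hb m)
  | lam => obtain ⟨m, rfl⟩ := exists_bag_of_mem_taylor (.lam _) he; exact absurd rfl (hb m)

/-- Each rule that cannot fire on `e` yields a clause of the grammar: `(0)` gives single heads,
`(σ₁)` and `(σ₃)` exclude `[λx.t]s` as head or as argument of a value, and `(β_r)` excludes bags as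
arguments of an abstraction. -/
theorem mem_tenTerm_cut (M : Lam) : ∀ {e : Res .sim}, e ∈ taylor M → Normal e →
    LamBot.IsA M.cut ∧ e ∈ tenTerm M.cut := by
  induction M with
  | var n => exact fun he _ => ⟨.ofB (.var n), he⟩
  | lam M ih =>
    rintro e ⟨m, hm, rfl⟩ hn
    have hu : ∀ u ∈ m, Normal u := fun u hu =>
      (hn.of_mem_bag (Multiset.mem_map_of_mem _ hu)).of_lam
    rw [Lam.cut]
    split_ifs with h
    · exact ⟨.ofB (.lam h), m, fun u hu' => (ih (hm u hu') (hu u hu')).2, rfl⟩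
    · refine ⟨.ofB .bot, ?_⟩
      -- Any resource would show the body to have an approximant; the bag is empty, as in the
      -- expansion of `⊥`.
      obtain rfl : m = 0 := Multiset.eq_zero_of_forall_notMem fun u hu' =>
        h (ih (hm u hu') (hu u hu')).1
      exact rfl
  | app P Q ihP ihQ =>
    rintro e ⟨s, hs, u, hu, rfl⟩ hn
    obtain ⟨hA, hs'⟩ := ihP hs hn.of_app_left
    obtain ⟨hA', hu'⟩ := ihQ hu hn.of_app_right
    rw [Lam.cut]
    cases P with
    | var n =>
      obtain ⟨m, rfl⟩ := exists_bag_of_mem_taylor (.var n) hs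
      obtain ⟨v, rfl⟩ := hn.eq_singleton
      obtain rfl := bag_mem_taylor_var.1 hs v (by simp)
      exact ⟨.ofB (.spine (.head n (isB_cut_of_not_isLet (t := bag 0) hA' hu
        (.inl hn.of_app_right) hn.not_isLet_right))), u, hu', rfl⟩
    | lam N =>
      obtain ⟨m, rfl⟩ := exists_bag_of_mem_taylor (.lam N) hs
      obtain ⟨v, rfl⟩ := hn.eq_singleton
      obtain ⟨t, ht, rfl⟩ := bag_mem_taylor_lam.1 hs v (by simp)
      have hB := isB_cut_of_not_isLet (t := bag 0) hA' hu (.inl hn.of_app_right) hn.not_isLet_right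
      have hS := isSpine_cut_of_isB hB hu hn.not_bag_right
      rw [Lam.cut] at hA hs' ⊢
      split_ifs at hA hs' ⊢ with h
      · cases hA with
        | ofB h' =>
          obtain ⟨m, hm, hb⟩ := hs'
          have hmem := exists_bag_map_lam_iff.1 ⟨m, hm, hb⟩ (lam t) (by simp)
          obtain ⟨t', ht', h'⟩ := hmem
          obtain rfl := lam_inj.1 h'
          exact ⟨.redex h hS, t, ht', u, hu', rfl⟩
      · simp [tenTerm] at hs'
    | app P₁ P₂ =>
      have hB := isB_cut_of_not_isLet hA hs (.inr hn) hn.not_isLet_left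
      have hS := isSpine_cut_of_isB hB hs (by
        rintro m rfl
        exact absurd (isValue_of_bag_mem_taylor hs) Lam.not_isValue_app)
      exact ⟨.ofB (.spine (.snoc hS hA')), s, hs', u, hu', rfl⟩

/-! ### Approximants have normal expansions, included in the Taylor expansion -/

/-- The Taylor expansion of a `λ⊥`-term. -/
def botTaylor : LamBot → Set (Res .sim)
  | .bot => {bag 0}
  | .var x => {t | ∃ n : ℕ, t = bag (Multiset.replicate n (var x))}
  | .lam N => {t | ∃ m : Multiset (Res .sim), (∀ u ∈ m, u ∈ botTaylor N) ∧ t = bag (m.map lam)}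
  | .app P Q => {t | ∃ s ∈ botTaylor P, ∃ u ∈ botTaylor Q, t = app s u}

theorem botTaylor_toBot (M : Lam) : botTaylor M.toBot = taylor M := by
  induction M with
  | var n => rfl
  | lam M ih => simp only [Lam.toBot, botTaylor, taylor, ih]
  | app P Q ih₁ ih₂ => simp only [Lam.toBot, botTaylor, taylor, ih₁, ih₂]

/-- Monotonicity fails for `tenTerm` outside the approximants: `⊥ A ⊑ x A`, but `[ ]t` is not in the
expansion of `x A`, whose head is `[x]`. Chains for `⊑` may pass through such terms, hence the
detour by `botTaylor`. -/
theorem LamBot.Le.botTaylor_subset {A B : LamBot} (h : LamBot.Le A B) :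
    botTaylor A ⊆ botTaylor B := by
  induction h with
  | bot_var n => rintro _ rfl; exact ⟨0, rfl⟩
  | bot_lam M => rintro _ rfl; exact ⟨0, by simp⟩
  | refl M => exact subset_rfl
  | trans _ _ ih₁ ih₂ => exact ih₁.trans ih₂
  | lam _ ih => rintro _ ⟨m, hm, rfl⟩; exact ⟨m, fun u hu => ih (hm u hu), rfl⟩
  | appL P _ ih => rintro _ ⟨s, hs, u, hu, rfl⟩; exact ⟨s, ih hs, u, hu, rfl⟩
  | appR P _ ih => rintro _ ⟨s, hs, u, hu, rfl⟩; exact ⟨s, hs, u, ih hu, rfl⟩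

theorem tenTerm_subset_botTaylor (A : LamBot) : tenTerm A ⊆ botTaylor A := by
  induction A with
  | bot => exact subset_rfl
  | var n => exact subset_rfl
  | lam A ih => rintro _ ⟨m, hm, rfl⟩; exact ⟨m, fun u hu => ih (hm u hu), rfl⟩
  | app P A ih₁ ih₂ =>
    cases P with
    | var x => rintro _ ⟨u, hu, rfl⟩; exact ⟨_, ⟨1, rfl⟩, u, ih₂ hu, rfl⟩
    | lam B =>
      rintro _ ⟨s, hs, u, hu, rfl⟩
      exact ⟨_, ih₁ ⟨{s}, by simpa using hs, by simp⟩, u, ih₂ hu, rfl⟩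
    | bot => rintro _ ⟨s, hs, u, hu, rfl⟩; exact ⟨_, ih₁ hs, u, ih₂ hu, rfl⟩
    | app => rintro _ ⟨s, hs, u, hu, rfl⟩; exact ⟨_, ih₁ hs, u, ih₂ hu, rfl⟩

theorem not_isLet_bag {m : Multiset (Res .val)} : ¬ IsLet (bag m) := by
  rintro ⟨t, s, h⟩; simp at h

mutual
theorem normal_of_isA : ∀ {A : LamBot}, LamBot.IsA A → ∀ e ∈ tenTerm A, Normal e
  | _, .ofB h, e, he => (normal_of_isB h e he).1
  | _, .redex hA hN, _, ⟨s, hs, u, hu, rfl⟩ =>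
    have ⟨h₁, h₂, h₃⟩ := normal_of_isSpine hN u hu
    normal_app (normal_bag (by simpa using normal_lam (normal_of_isA hA s hs))) h₁ not_isLet_bag
      fun _ hm => ⟨_, (bag_inj.1 hm).symm, h₂, .inr h₃⟩
theorem normal_of_isB : ∀ {B : LamBot}, LamBot.IsB B → ∀ e ∈ tenTerm B, Normal e ∧ ¬ IsLet e
  | _, .var n, _, ⟨_, rfl⟩ =>
    ⟨normal_bag fun v hv => by rw [Multiset.eq_of_mem_replicate hv]; exact normal_var n,
      not_isLet_bag⟩
  | _, .lam hA, _, ⟨m, hm, rfl⟩ =>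
    ⟨normal_bag fun v hv => by
      obtain ⟨t, ht, rfl⟩ := Multiset.mem_map.1 hv
      exact normal_lam (normal_of_isA hA t (hm t ht)), not_isLet_bag⟩
  | _, .bot, _, rfl => ⟨normal_bag (by simp), not_isLet_bag⟩
  | _, .spine h, e, he => ⟨(normal_of_isSpine h e he).1, (normal_of_isSpine h e he).2.1⟩
theorem normal_of_isSpine : ∀ {N : LamBot}, LamBot.IsSpine N → ∀ e ∈ tenTerm N,
    Normal e ∧ ¬ IsLet e ∧ ∀ m, e ≠ bag m
  | _, .head n hB, _, ⟨u, hu, rfl⟩ =>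
    have ⟨h₁, h₂⟩ := normal_of_isB hB u hu
    ⟨normal_app (normal_bag (by simpa using normal_var n)) h₁ not_isLet_bag
      fun _ hm => ⟨_, (bag_inj.1 hm).symm, h₂, .inl ⟨n, rfl⟩⟩,
      fun ⟨_, _, h⟩ => by simp at h, by simp⟩
  -- A spine is an application, so the last clause of `tenTerm` is the relevant one.
  | .app (.app _ _) _, .snoc hN hA, _, ⟨s, hs, u, hu, rfl⟩ =>
    have ⟨h₁, _, h₃⟩ := normal_of_isSpine hN s hs
    ⟨normal_app h₁ (normal_of_isA hA u hu) ‹_› fun m hm => absurd hm (h₃ m),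
      fun ⟨_, _, h⟩ => h₃ _ (app_inj.1 h).1, by simp⟩
end

/-! ### Simulation of reduction backwards in the Taylor expansion -/

/-- The elements of the Taylor expansion which have a single resource at the head of every
application of a value. -/
def linTaylor : Lam → Set (Res .sim)
  | .var x => {t | ∃ n : ℕ, t = bag (Multiset.replicate n (var x))}
  | .lam N => {t | ∃ m : Multiset (Res .sim), (∀ u ∈ m, u ∈ linTaylor N) ∧ t = bag (m.map lam)}
  | .app P Q => {t | ∃ s ∈ linTaylor P, ∃ u ∈ linTaylor Q,
      (P.IsValue → ∃ v, s = bag {v}) ∧ t = app s u}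

theorem linTaylor_subset (M : Lam) : linTaylor M ⊆ taylor M := by
  induction M with
  | var n => exact subset_rfl
  | lam M ih => rintro _ ⟨m, hm, rfl⟩; exact ⟨m, fun u hu => ih (hm u hu), rfl⟩
  | app P Q ih₁ ih₂ => rintro _ ⟨s, hs, u, hu, -, rfl⟩; exact ⟨s, ih₁ hs, u, ih₂ hu, rfl⟩

theorem mem_linTaylor_of_normal (M : Lam) :
    ∀ {e : Res .sim}, e ∈ taylor M → Normal e → e ∈ linTaylor M := by
  induction M with
  | var n => exact fun he _ => he
  | lam M ih =>
    rintro _ ⟨m, hm, rfl⟩ hn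
    exact ⟨m, fun u hu =>
      ih (hm u hu) (hn.of_mem_bag (Multiset.mem_map_of_mem _ hu)).of_lam, rfl⟩
  | app P Q ih₁ ih₂ =>
    rintro _ ⟨s, hs, u, hu, rfl⟩ hn
    refine ⟨s, ih₁ hs hn.of_app_left, u, ih₂ hu hn.of_app_right, fun hP => ?_, rfl⟩
    obtain ⟨m, rfl⟩ := exists_bag_of_mem_taylor hP hs
    obtain ⟨v, rfl⟩ := hn.eq_singleton
    exact ⟨v, rfl⟩

theorem bag_mem_linTaylor_var {x : ℕ} {m : Multiset (Res .val)} :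
    bag m ∈ linTaylor (.var x) ↔ ∀ v ∈ m, v = var x := bag_mem_taylor_var

theorem bag_mem_linTaylor_lam {N : Lam} {m : Multiset (Res .val)} :
    bag m ∈ linTaylor (.lam N) ↔ ∀ v ∈ m, ∃ t ∈ linTaylor N, v = lam t := exists_bag_map_lam_iff

theorem bag_mem_linTaylor {V : Lam} (hV : V.IsValue) {m : Multiset (Res .val)} :
    bag m ∈ linTaylor V ↔ ∀ v ∈ m, bag {v} ∈ linTaylor V := by
  cases hV <;> simp [bag_mem_linTaylor_var, bag_mem_linTaylor_lam]

theorem exists_bag_of_mem_linTaylor {V : Lam} (hV : V.IsValue) {e : Res .sim}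
    (h : e ∈ linTaylor V) : ∃ m, e = bag m :=
  exists_bag_of_mem_taylor hV (linTaylor_subset V h)

/-- The number of elements of a bag. -/
def Res.width : {s : RSort} → Res s → ℕ
  | .val, _ => 0
  | .sim, t => Sum.elim (fun _ => 0) Multiset.card (view t)
  | .bag, b => Multiset.card (view b)

theorem Res.width_bag (m : Multiset (Res .val)) : width (bag m) = Multiset.card m := by
  rw [width, view_bag]; rfl

theorem Res.width_app (s t : Res .sim) : width (app s t) = 0 := by
  rw [width, view_app]; rfl

theorem exists_singleton_of_width {V : Lam} (hV : V.IsValue) {e : Res .sim}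
    (h : e ∈ linTaylor V) (hw : width e = 1) : ∃ v, e = bag {v} := by
  obtain ⟨m, rfl⟩ := exists_bag_of_mem_linTaylor hV h
  rw [width_bag, Multiset.card_eq_one] at hw
  obtain ⟨v, rfl⟩ := hw
  exact ⟨v, rfl⟩

theorem Res.LSubst.width_eq {s : RSort} {k : ℕ} {vs : Multiset (Res .val)} {e e' : Res s}
    (h : LSubst k vs e e') : width e = width e' := by
  induction h with
  | app => rw [width_app, width_app]
  | bag_nil => rfl
  | bag_cons _ _ _ ih =>
    rw [width_bag, width_bag] at ih ⊢
    rw [Multiset.card_cons, Multiset.card_cons, ih]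
  | _ => rfl

theorem Res.width_shift (c : ℕ) (e : Res .sim) : width (shift c e) = width e :=
  (induction (p := fun _ => True) (q := fun e => width (shift c e) = width e) (fun _ => trivial)
    (fun _ _ => trivial) (fun _ _ _ _ => by rw [shift_app, width_app, width_app])
    (fun _ _ => by rw [shift_bag, width_bag, width_bag, Multiset.card_map])).2 e

theorem exists_of_mem_linTaylor_shift (M : Lam) : ∀ {c : ℕ} {e : Res .sim},
    e ∈ linTaylor (M.shift c) → ∃ e' ∈ linTaylor M, e = shift c e' := by
  induction M with
  | var n =>
    rintro c _ ⟨k, rfl⟩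
    exact ⟨_, ⟨k, rfl⟩, by rw [shift_bag, Multiset.map_replicate, shift_var]⟩
  | lam M ih =>
    rintro c _ ⟨m, hm, rfl⟩
    obtain ⟨m', hm', rfl⟩ := exists_eq_map fun u hu => ih (hm u hu)
    refine ⟨_, ⟨m', hm', rfl⟩, ?_⟩
    simp [shift_bag, shift_lam]
  | app P Q ih₁ ih₂ =>
    rintro c _ ⟨s, hs, u, hu, hv, rfl⟩
    obtain ⟨s, hs', rfl⟩ := ih₁ hs
    obtain ⟨u, hu', rfl⟩ := ih₂ hu
    refine ⟨_, ⟨s, hs', u, hu', fun hP => ?_, rfl⟩, by rw [shift_app]⟩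
    obtain ⟨v, hv⟩ := hv (hP.shift c)
    exact exists_singleton_of_width hP hs' (by
      rw [← width_shift c, hv, width_bag, Multiset.card_singleton])

theorem exists_lsubst_bag {k : ℕ} {p q : Res .val → Prop} {m' : Multiset (Res .val)}
    (h : ∀ v' ∈ m', ∃ v vs, p v ∧ (∀ w ∈ vs, q w) ∧ LSubst k vs v v') :
    ∃ m vs, (∀ v ∈ m, p v) ∧ (∀ w ∈ vs, q w) ∧ LSubst k vs (bag m) (bag m') := by
  induction m' using Multiset.induction with
  | empty => exact ⟨0, 0, by simp, by simp, .bag_nil k⟩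
  | cons v' m' ih =>
    rw [Multiset.forall_mem_cons] at h
    obtain ⟨⟨v, vs, hv, hvs, hs⟩, h⟩ := h
    obtain ⟨m, ws, hm, hws, hs'⟩ := ih h
    refine ⟨v ::ₘ m, vs + ws, Multiset.forall_mem_cons.2 ⟨hv, hm⟩, fun w hw => ?_, .bag_cons hs hs'⟩
    exact (Multiset.mem_add.1 hw).elim (hvs w) (hws w)

/-- The pieces of `e` lying over the copies of `V` are collected into `vs`, each leaving a variable
behind. Linear substitution keeps the width of simple terms, so heads stay singletons. -/
theorem exists_lsubst_of_mem_linTaylor (M : Lam) : ∀ {k : ℕ} {V : Lam} {e : Res .sim},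
    V.IsValue → e ∈ linTaylor (Lam.subst k V M) →
      ∃ t ∈ linTaylor M, ∃ vs, bag vs ∈ linTaylor V ∧ LSubst k vs t e := by
  -- Over a value `e` is a bag; it suffices to decompose its elements separately and add up the
  -- resources.
  have value : ∀ {M : Lam} {k : ℕ} {V : Lam} {e : Res .sim}, M.IsValue → V.IsValue →
      e ∈ linTaylor (Lam.subst k V M) →
      (∀ v', bag {v'} ∈ linTaylor (Lam.subst k V M) → ∃ v vs, bag {v} ∈ linTaylor M ∧
        (∀ w ∈ vs, bag {w} ∈ linTaylor V) ∧ LSubst k vs v v') →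
      ∃ t ∈ linTaylor M, ∃ vs, bag vs ∈ linTaylor V ∧ LSubst k vs t e := by
    intro M k V e hM hV he h
    have hMV := hM.subst hV k
    obtain ⟨m', rfl⟩ := exists_bag_of_mem_linTaylor hMV he
    obtain ⟨m, vs, hm, hvs, hs⟩ :=
      exists_lsubst_bag fun v' hv' => h v' ((bag_mem_linTaylor hMV).1 he v' hv')
    exact ⟨_, (bag_mem_linTaylor hM).2 hm, vs, (bag_mem_linTaylor hV).2 hvs, hs⟩
  induction M with
  | var n =>
    intro k V e hV he
    refine value (.var n) hV he fun v' hv' => ⟨var n, ?_⟩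
    have hn : bag {var n} ∈ linTaylor (.var n) := bag_mem_linTaylor_var.2 (by simp)
    rcases lt_trichotomy n k with h | h | h
    · simp only [Lam.subst, h.ne, h, if_true, if_false] at hv'
      obtain rfl := bag_mem_linTaylor_var.1 hv' v' (by simp)
      exact ⟨0, hn, by simp, .var_lt h⟩
    · subst h
      simp only [Lam.subst, if_true] at hv'
      exact ⟨{v'}, hn, by simpa using hv', .var_eq _ _⟩
    · simp only [Lam.subst, h.ne', h.not_gt, if_false] at hv'
      obtain rfl := bag_mem_linTaylor_var.1 hv' v' (by simp)
      exact ⟨0, hn, by simp, .var_gt h⟩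
  | lam M ih =>
    intro k V e hV he
    refine value (.lam M) hV he fun v' hv' => ?_
    obtain ⟨u, hu, rfl⟩ := bag_mem_linTaylor_lam.1 hv' v' (by simp)
    obtain ⟨t, ht, vs, hvs, hs⟩ := ih (hV.shift 0) hu
    obtain ⟨b, hb, hb'⟩ := exists_of_mem_linTaylor_shift V hvs
    obtain ⟨ws, rfl⟩ := exists_bag_of_mem_linTaylor hV hb
    rw [shift_bag, bag_inj] at hb'
    subst hb'
    exact ⟨lam t, ws, bag_mem_linTaylor_lam.2 (by simpa using ht),
      (bag_mem_linTaylor hV).1 hb, .lam hs⟩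
  | app P Q ih₁ ih₂ =>
    rintro k V _ hV ⟨s, hs, u, hu, hv, rfl⟩
    obtain ⟨s', hs', vs, hvs, h₁⟩ := ih₁ hV hs
    obtain ⟨u', hu', ws, hws, h₂⟩ := ih₂ hV hu
    refine ⟨_, ⟨s', hs', u', hu', fun hP => ?_, rfl⟩, vs + ws, ?_, .app h₁ h₂⟩
    · obtain ⟨v, rfl⟩ := hv (hP.subst hV k)
      exact exists_singleton_of_width hP hs' (by
        rw [h₁.width_eq, width_bag, Multiset.card_singleton])
    · rw [bag_mem_linTaylor hV] at hvs hws ⊢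
      exact fun w hw => (Multiset.mem_add.1 hw).elim (hvs w) (hws w)

namespace Res

theorem ESteps.lam {t t' : Res .sim} (h : ESteps t t') : ESteps (lam t) (lam t') :=
  star_lift Res.lam (fun ⟨_, h, ht⟩ => ⟨_, .lam h, Set.mem_image_of_mem _ ht⟩) h

theorem ESteps.app {s s' t t' : Res .sim} (h : ESteps s s') (h' : ESteps t t') :
    ESteps (app s t) (app s' t') :=
  (star_lift (fun s => Res.app s t)
    (fun ⟨_, h, ht⟩ => ⟨_, .appL _ h, Set.mem_image_of_mem (Res.app · t) ht⟩) h).trans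
  (star_lift (fun t => Res.app s' t)
    (fun ⟨_, h, ht⟩ => ⟨_, .appR _ h, Set.mem_image_of_mem (Res.app s') ht⟩) h')

theorem ESteps.bag_cons {v v' : Res .val} (h : ESteps v v') (m : Multiset (Res .val)) :
    ESteps (bag (v ::ₘ m)) (bag (v' ::ₘ m)) :=
  star_lift (fun v => bag (v ::ₘ m))
    (fun ⟨_, h, ht⟩ => ⟨_, .bag _ h, Set.mem_image_of_mem (fun v => bag (v ::ₘ m)) ht⟩) h

/-- Elements are reduced one at a time; `m₀` stands for those waiting or already treated. -/
theorem exists_esteps_bag {p : Res .val → Prop} {m' : Multiset (Res .val)}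
    (h : ∀ v' ∈ m', ∃ v, p v ∧ ESteps v v') :
    ∃ m, (∀ v ∈ m, p v) ∧ Multiset.card m = Multiset.card m' ∧
      ∀ m₀, ESteps (bag (m + m₀)) (bag (m' + m₀)) := by
  induction m' using Multiset.induction with
  | empty => exact ⟨0, by simp, rfl, fun _ => .refl⟩
  | cons v' m' ih =>
    rw [Multiset.forall_mem_cons] at h
    obtain ⟨⟨v, hv, hs⟩, h⟩ := h
    obtain ⟨m, hm, hc, hs'⟩ := ih h
    refine ⟨v ::ₘ m, Multiset.forall_mem_cons.2 ⟨hv, hm⟩, by simp [hc], fun m₀ => ?_⟩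
    have := hs' (v ::ₘ m₀)
    rw [Multiset.add_cons, Multiset.add_cons] at this
    rw [Multiset.cons_add, Multiset.cons_add]
    exact this.trans (hs.bag_cons _)

end Res

/-- Linearity is essential for the `σ`-rules: the head bag over `λx.MP` must hold exactly one
resource for its argument to be moved back outside. The width clause keeps heads that are values
linear when the step takes place inside them. -/
theorem Lam.Step.exists_esteps {M N : Lam} (h : Lam.Step M N) : ∀ {e : Res .sim},
    e ∈ linTaylor N →
      ∃ e₀ ∈ linTaylor M, ESteps e₀ e ∧ (M.IsValue → width e₀ = width e) := by
  induction h with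
  | beta M V hV =>
    intro e he
    obtain ⟨t, ht, vs, hvs, hs⟩ := exists_lsubst_of_mem_linTaylor M hV he
    refine ⟨_, ⟨bag {Res.lam t}, bag_mem_linTaylor_lam.2 (by simpa using ht), bag vs, hvs,
      fun _ => ⟨_, rfl⟩, rfl⟩, .single ⟨_, .beta t vs, hs⟩, nofun⟩
  | sigma1 M N P =>
    rintro _ ⟨s, hs, u, hu, hv, rfl⟩
    obtain ⟨v, rfl⟩ := hv (.lam _)
    obtain ⟨_, ⟨r, hr, p, hp, -, rfl⟩, rfl⟩ := bag_mem_linTaylor_lam.1 hs v (by simp)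
    obtain ⟨p, hp', rfl⟩ := exists_of_mem_linTaylor_shift P hp
    exact ⟨_, ⟨_, ⟨bag {Res.lam r}, bag_mem_linTaylor_lam.2 (by simpa using hr), u, hu,
      fun _ => ⟨_, rfl⟩, rfl⟩, p, hp', nofun, rfl⟩, .single ⟨_, .sigma1 _ _ _, rfl⟩, nofun⟩
  | sigma3 V M N hV =>
    rintro _ ⟨s, hs, u, hu, hv, rfl⟩
    obtain ⟨v, rfl⟩ := hv (.lam _)
    obtain ⟨_, ⟨r, hr, p, hp, hw, rfl⟩, rfl⟩ := bag_mem_linTaylor_lam.1 hs v (by simp)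
    obtain ⟨w, rfl⟩ := hw (hV.shift 0)
    obtain ⟨r, hr', hw⟩ := exists_of_mem_linTaylor_shift V hr
    obtain ⟨w', rfl⟩ := exists_singleton_of_width hV hr' (by
      rw [← width_shift 0, ← hw, width_bag, Multiset.card_singleton])
    refine ⟨_, ⟨_, hr', _, ⟨bag {Res.lam p}, bag_mem_linTaylor_lam.2 (by simpa using hp), u, hu,
      fun _ => ⟨_, rfl⟩, rfl⟩, fun _ => ⟨_, rfl⟩, rfl⟩, .single ⟨_, .sigma3 _ _ _, ?_⟩, nofun⟩
    rw [hw, shift_bag, Multiset.map_singleton]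
    exact rfl
  | @lam M N h ih =>
    intro e he
    obtain ⟨m', rfl⟩ := exists_bag_of_mem_linTaylor (.lam N) he
    obtain ⟨m, hm, hc, hs⟩ := exists_esteps_bag (p := fun v => bag {v} ∈ linTaylor (.lam M))
      (m' := m') fun v' hv' => by
        obtain ⟨u, hu, rfl⟩ := bag_mem_linTaylor_lam.1 he v' hv'
        obtain ⟨t, ht, hs, -⟩ := ih hu
        exact ⟨Res.lam t, bag_mem_linTaylor_lam.2 (by simpa using ht), hs.lam⟩
    refine ⟨bag m, (bag_mem_linTaylor (.lam M)).2 hm, by simpa using hs 0, fun _ => ?_⟩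
    rw [width_bag, width_bag, hc]
  | appL P h ih =>
    rintro _ ⟨s, hs, u, hu, hv, rfl⟩
    obtain ⟨s₀, hs₀, hs', hw⟩ := ih hs
    refine ⟨_, ⟨s₀, hs₀, u, hu, fun hM => ?_, rfl⟩, hs'.app .refl, nofun⟩
    obtain ⟨v, rfl⟩ := hv (h.isValue hM)
    exact exists_singleton_of_width hM hs₀ (by rw [hw hM, width_bag, Multiset.card_singleton])
  | appR P h ih =>
    rintro _ ⟨s, hs, u, hu, hv, rfl⟩
    obtain ⟨u₀, hu₀, hs', -⟩ := ih hu
    exact ⟨_, ⟨s, hs, u₀, hu₀, hv, rfl⟩, .app .refl hs', nofun⟩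

theorem Lam.Steps.exists_esteps {M N : Lam} (h : Lam.Steps M N) {e : Res .sim}
    (he : e ∈ linTaylor N) : ∃ e₀ ∈ linTaylor M, ESteps e₀ e := by
  induction h generalizing e with
  | refl => exact ⟨e, he, .refl⟩
  | tail _ h ih =>
    obtain ⟨e₁, he₁, h₁, -⟩ := h.exists_esteps he
    obtain ⟨e₀, he₀, h₀⟩ := ih he₁
    exact ⟨e₀, he₀, h₀.trans h₁⟩

end CbV

-- The commutation theorem

theorem mainTheorem1 (M : CbV.Lam) :
    CbV.ten (CbV.bohmTree M) = CbV.Res.NF (CbV.taylor M) := by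
  ext a
  simp only [CbV.ten, Set.mem_iUnion, CbV.mem_bohmTree, CbV.Res.mem_NF_iff]
  constructor
  · rintro ⟨⟨A, hA⟩, ⟨N, hN, hle⟩, ha⟩
    have hn := CbV.normal_of_isA hA a ha
    have haN := hle.botTaylor_subset (CbV.tenTerm_subset_botTaylor A ha)
    rw [CbV.botTaylor_toBot] at haN
    obtain ⟨e, he, hs⟩ := hN.exists_esteps (CbV.mem_linTaylor_of_normal N haN hn)
    exact ⟨e, CbV.linTaylor_subset M he, hs, hn⟩
  · rintro ⟨e, he, hs, hn⟩
    obtain ⟨N, hN, ha⟩ :=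
      CbV.Approx.exists_mem_taylor (hs.approx (CbV.approx_of_mem_taylor he)) hn
    obtain ⟨hA, ha'⟩ := CbV.mem_tenTerm_cut N ha hn
    exact ⟨⟨N.cut, hA⟩, ⟨N, hN, N.cut_le⟩, ha'⟩
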